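/- **Setting.** Let $n\ge 1$ and $\mathcal Y=\{1,\dots,n\}$. An $n$-target Stackelberg security game consists of a closed, convex set $\mathcal X\subseteq[0,1]^n$ that is downward closed (if $x\in\mathcal X$, $x'\in[0,1]^n$ and $x'\le x$ entry-wise, then $x'\in\mathcal X$), and, for each target $y\in\mathcal Y$, continuous functions $u^y,v^y:[0,1]\to[0,1]$, with $u^y$ strictly increasing and $v^y$ strictly decreasing. If the principal plays $x\in\mathcal X$ and the agent attacks $y$, their payoffs are $u(x,y)=u^y(x_y)$ and $v(x,y)=v^y(x_y)$. The game has slope bound $C\ge 1$ if for all $y$ and $0\le s<t\le 1$ $$\frac1C\le\frac{v^y(s)-v^y(t)}{t-s}\le C,\qquad 0<\frac{u^y(t)-u^y(s)}{t-s}\le C .$$ Let $\mathrm{BR}^{\varepsilon}(x)=\{y: v(x,y)\ge\max_{y'}v(x,y')-\varepsilon\}$ and $\mathrm{BR}=\mathrm{BR}^0$. An $\varepsilon$-approximate best response oracle answers each query $x\in\mathcal X$ with some element of $\mathrm{BR}^\varepsilon(x)$ (answers may depend on the history of queries). A strategy $x$ is conservative if $x_y>0$ only for $y\in \mathrm{BR}(x)$.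 Let $x^\star\in\mathcal X$ be the conservative strategy that maximizes $\max_{y\in \mathrm{BR}(x)}u(x,y)$ over $x\in\mathcal X$. **The algorithm CLINCH.** Input: $\mathcal X$, $C$, $\delta\in(0,1]$, $\varepsilon$, vectors $\underline x,\overline x\in\mathbb R^n$, and an oracle. Set $\lambda=\delta/(4C^2)$, $S=\mathcal X$, $\mathcal R=\mathcal Y$, $y=1$, and replace $\underline x$ by $\max(\underline x,\mathbf 0_n)$ entry-wise. While $y\in\mathcal R$: (i) for every $y'$ with $\underline x+\lambda\mathbf e_{y'}\notin S$, remove $y'$ from $\mathcal R$ and set $\overline x_{y'}\leftarrow\underline x_{y'}$; (ii) set $S\leftarrow\{x'\in\mathcal X:\underline x\le x'\le\overline x\}$; (iii) let $x$ be the centroid of $S$ (the expectation of the uniform distribution on $S$, taken in the dimension of the affine hull of $S$); (iv) query the oracle at $x$ and let $y$ be its answer; (v) set $\underline x_y\leftarrow\max(\underline x_y,\;x_y-C\varepsilon)$. After the loop, with the final $x$ and $\underline x$ fixed, do the following for each target $y$: start with $\ell=\underline x_y$, $r=x_y$; while $r-\ell\ge\lambda$, let $m=(\ell+r)/2$ and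 query the oracle at $x$ with its $y$-th coordinate replaced by $m$; if the answer is $y$ set $\ell\leftarrow m$, otherwise set $r\leftarrow m$; at the end put $\hat x_y=\ell$. Return $\hat x$. **Theorem.** There is a universal constant $K>0$ such that the following holds for every $n\ge1$, every $n$-target Stackelberg security game with slope bound $C$, and every $0<\delta\le1$. Let $\varepsilon=\frac{\delta}{33C^3n}$, let the oracle be any $\varepsilon$-approximate best response oracle, and let $\underline x,\overline x\in\mathbb R^n$ satisfy $\underline x\le x^\star\le\overline x$ entry-wise. Then CLINCH terminates and returns $\hat x\in\mathcal X$ with $\|\hat x-x^\star\|_\infty\le\delta$, after at most $$K\,n\,\max\Bigl\{1,\ \log\frac{C^2\alpha n}{\delta}\Bigr\}$$ oracle queries in total, where $\alpha=\max_{y\in\mathcal Y}(\overline x_y-\underline x_y)$ (with $\log 0=-\infty$). In particular, with $\underline x=\mathbf 0_n$ and $\overline x=\mathbf 1_n$ the number of queries is at most $K\,n\,\max\{1,\log\frac{Cn}{\delta}\}$. -/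

import Mathlib

open MeasureTheory ProbabilityTheory

/-- An `n`-target Stackelberg security game. The payoff of the principal (resp. agent) when the
principal plays `x ∈ X` and the agent attacks `y` is `u y (x y)` (resp. `v y (x y)`); the payoff
functions are only meaningful on `[0, 1]`. -/
structure SecurityGame (n : ℕ) where
  X : Set (Fin n → ℝ)
  subset_cube : X ⊆ Set.Icc 0 1
  isClosed : IsClosed X
  convex : Convex ℝ X
  downwardClosed : ∀ x ∈ X, ∀ x' ∈ Set.Icc (0 : Fin n → ℝ) 1, x' ≤ x → x' ∈ X
  u : Fin n → ℝ → ℝ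
  v : Fin n → ℝ → ℝ
  u_mapsTo : ∀ y, Set.MapsTo (u y) (Set.Icc 0 1) (Set.Icc 0 1)
  v_mapsTo : ∀ y, Set.MapsTo (v y) (Set.Icc 0 1) (Set.Icc 0 1)
  u_strictMono : ∀ y, StrictMonoOn (u y) (Set.Icc 0 1)
  v_strictAnti : ∀ y, StrictAntiOn (v y) (Set.Icc 0 1)
  u_continuous : ∀ y, ContinuousOn (u y) (Set.Icc 0 1)
  v_continuous : ∀ y, ContinuousOn (v y) (Set.Icc 0 1)

namespace SecurityGame

variable {n : ℕ} (G : SecurityGame n)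

/-- The slope bound `C ≥ 1`. -/
def HasSlopeBound (C : ℝ) : Prop :=
  1 ≤ C ∧ ∀ y : Fin n, ∀ s t : ℝ, 0 ≤ s → s < t → t ≤ 1 →
    (1 / C ≤ (G.v y s - G.v y t) / (t - s) ∧ (G.v y s - G.v y t) / (t - s) ≤ C) ∧
    (0 < (G.u y t - G.u y s) / (t - s) ∧ (G.u y t - G.u y s) / (t - s) ≤ C)

/-- The `ε`-approximate best responses to `x`: targets `y` with
`v(x, y) ≥ max_{y'} v(x, y') - ε`. -/
def approxBestResp (ε : ℝ) (x : Fin n → ℝ) : Set (Fin n) :=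
  {y | ∀ y', G.v y' (x y') - ε ≤ G.v y (x y)}

/-- The best responses to `x`: targets `y` with `v(x, y) = max_{y'} v(x, y')`. -/
def bestResp (x : Fin n → ℝ) : Set (Fin n) :=
  {y | ∀ y', G.v y' (x y') ≤ G.v y (x y)}

/-- The payoff of the principal when the agent best responds to `x`, breaking ties in favor of the
principal: `max_{y ∈ BestResp x} u(x, y)`. -/
noncomputable def principalValue (x : Fin n → ℝ) : ℝ :=
  ⨆ y : G.bestResp x, G.u y (x y)

/-- A strategy that covers only targets that are best responses. -/
def IsConservative (x : Fin n → ℝ) : Prop :=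
  ∀ y, 0 < x y → y ∈ G.bestResp x

/-- `x` is a conservative strategy that is optimal for the principal against a best responding
agent. -/
def IsConservativeOptimum (x : Fin n → ℝ) : Prop :=
  x ∈ G.X ∧ G.IsConservative x ∧ ∀ x' ∈ G.X, G.principalValue x' ≤ G.principalValue x

/-- An `ε`-approximate best response oracle. The `t`-th query of a run is answered by `oracle t`,
so answers to repeated queries need not agree and may depend on the history of the run. -/
def IsApproxOracle (ε : ℝ) (oracle : ℕ → (Fin n → ℝ) → Fin n) : Prop :=
  ∀ t, ∀ x ∈ G.X, oracle t x ∈ G.approxBestResp ε x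

end SecurityGame

namespace Clinch

/-- The uniform distribution over a set `S`, possibly of lower dimension: normalized Hausdorff
measure on `S`, of the dimension of the affine hull of `S`. -/
noncomputable def unif {n : ℕ} (S : Set (Fin n → ℝ)) : Measure (Fin n → ℝ) :=
  ProbabilityTheory.cond (Measure.hausdorffMeasure (Module.finrank ℝ (vectorSpan ℝ S) : ℝ)) S

/-- The centroid of `S`, the expectation of a uniform point of `S`. -/
noncomputable def centroid {n : ℕ} (S : Set (Fin n → ℝ)) : Fin n → ℝ :=
  ∫ z, z ∂(unif S)

open Classical in
/-- One round of `while cond do body`: `Sum.inl` is the final state, `Sum.inr` asks to go on. -/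
noncomputable def whileStep {σ : Type} (cond : σ → Prop) (body : σ → σ) (s : σ) : σ ⊕ σ :=
  if cond s then Sum.inr (body s) else Sum.inl s

/-- `while cond do body`, started in a given state; undefined if the loop does not terminate. -/
noncomputable def whileLoop {σ : Type} (cond : σ → Prop) (body : σ → σ) (s : σ) : Part σ :=
  PFun.fix (PFun.lift (whileStep cond body)) s

/-- The variables of the main loop, together with the number `queries` of oracle calls so far. -/
structure LoopState (n : ℕ) where
  lo : Fin n → ℝ
  hi : Fin n → ℝ
  S : Set (Fin n → ℝ)
  R : Set (Fin n)
  x : Fin n → ℝ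
  y : Fin n
  queries : ℕ

/-- One iteration of the main loop: lock every target whose slack is too small, query the centroid
of the search region, and raise the lower bound of the attacked target. -/
noncomputable def loopBody {n : ℕ} (X : Set (Fin n → ℝ)) (C ε lam : ℝ)
    (oracle : ℕ → (Fin n → ℝ) → Fin n) (s : LoopState n) : LoopState n :=
  open Classical in
  let locked : Set (Fin n) := {y' | s.lo + Pi.single y' lam ∉ s.S}
  let R := s.R \ locked
  let hi : Fin n → ℝ := fun y' => if y' ∈ locked then s.lo y' else s.hi y'
  let S := {x' | x' ∈ X ∧ s.lo ≤ x' ∧ x' ≤ hi}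
  let x := centroid S
  let y := oracle s.queries x
  let lo := Function.update s.lo y (max (s.lo y) (x y - C * ε))
  { lo := lo, hi := hi, S := S, R := R, x := x, y := y, queries := s.queries + 1 }

/-- The variables `ℓ`, `u` of a binary search, and the number of oracle calls so far. -/
structure SearchState where
  l : ℝ
  u : ℝ
  queries : ℕ

open Classical in
/-- One iteration of the binary search for target `y`. -/
noncomputable def searchBody {n : ℕ} (oracle : ℕ → (Fin n → ℝ) → Fin n) (x : Fin n → ℝ)
    (y : Fin n) (s : SearchState) : SearchState :=
  let m := (s.u + s.l) / 2
  if oracle s.queries (Function.update x y m) = y then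
    { l := m, u := s.u, queries := s.queries + 1 }
  else
    { l := s.l, u := m, queries := s.queries + 1 }

/-- `ConserveMass`: for each target in turn, a binary search between the lower bound and `x`.
Started after `q` oracle calls, it returns the final strategy and the total number of calls. -/
noncomputable def conserveMass {n : ℕ} (oracle : ℕ → (Fin n → ℝ) → Fin n) (x : Fin n → ℝ)
    (lam : ℝ) (lo : Fin n → ℝ) (q : ℕ) : Part ((Fin n → ℝ) × ℕ) :=
  (List.finRange n).foldlM
    (fun (acc : (Fin n → ℝ) × ℕ) (y : Fin n) => do
      let s ← whileLoop (fun s : SearchState => lam ≤ s.u - s.l) (searchBody oracle x y)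
        { l := lo y, u := x y, queries := acc.2 }
      pure (Function.update acc.1 y s.l, s.queries))
    (x, q)

/-- The initial state of the main loop. Negative entries of the lower bound are raised to `0`. -/
def initState {n : ℕ} [NeZero n] (X : Set (Fin n → ℝ)) (lo hi : Fin n → ℝ) : LoopState n :=
  { lo := fun y => max (lo y) 0, hi := hi, S := X, R := Set.univ, x := 0, y := 0, queries := 0 }

/-- The algorithm `Clinch`, with strategy space `X`, slope bound `C`, accuracy `δ`, entry-wise
bounds `lo`, `hi`, and an `ε`-approximate best response oracle. If it terminates, its value is the
returned strategy and the total number of oracle queries. -/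
noncomputable def clinch {n : ℕ} [NeZero n] (X : Set (Fin n → ℝ)) (C δ ε : ℝ) (lo hi : Fin n → ℝ)
    (oracle : ℕ → (Fin n → ℝ) → Fin n) : Part ((Fin n → ℝ) × ℕ) := do
  let lam := δ / (4 * C ^ 2)
  let s ← whileLoop (fun s : LoopState n => s.y ∈ s.R) (loopBody X C ε lam oracle)
    (initState X lo hi)
  conserveMass oracle s.x lam s.lo s.queries

end Clinch

/-!
The agent's payoff `max_y v(x, y)` is minimized over the strategy space by the conservative optimum
`xs` (`IsConservativeOptimum.exists_le`). Hence a target attacked in reply to `x` is covered by `x`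
at most `C * ε` more than by `xs` (`sub_le_of_mem_approxBestResp`), so that the lower bounds of
the algorithm stay valid, and the main loop stops at a strategy which covers every target almost as
much as `xs` and in which the agent's best payoff is nearly minimal. From there, each binary search
can compare a coverage with that of `xs`, again up to `O(C * ε + C ^ 2 * lam)`.

The number of rounds is bounded by a volume argument. The search region lies in a coordinate flat,
whose dimension drops when a target is locked; `fatten` thickens it by a factor `[0, lam]` in every
locked coordinate, so that all the rounds take place in `ℝ ^ n`, and the centroid under the
normalized Hausdorff measure becomes an ordinary centroid (`unif_eq_map_cond_fatten`).

* A cut at the centroid in a coordinate direction keeps about half of the volume. No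
  Brunn-Minkowski inequality is needed: above its lower bound, the region is downward closed, and
  reflecting a part of it in a hyperplane shows that the mass beyond height `a` is at most
  `c / (2 * a)` of the whole, where `c` is the height of the centroid
  (`two_mul_volume_lt_le_moment`). Here `a = c - C * ε`, and `C * ε` is a small part of `c` because
  `c ≥ lam / (n + 1)` in a direction of width `lam` (`mul_volume_le_moment`).
* Locking targets increases the volume of the thickened region by at most a factor `33 * n ^ 2` for
  each target (`volume_fatten_cut`).

Since each target is locked at most once, and the volume lies between `(lam / n) ^ n` and `α ^ n`
from the second round on, the number of rounds is `O(n * log (n * α / lam))`.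
-/

/-! ### Volume and first moments of convex bodies -/

namespace Clinch

section Volume

variable {n : ℕ}

/-- Change of variables for the affine map `t ↦ d * t + b` with diagonal linear part. -/
lemma setIntegral_image_mul_add (d b : Fin n → ℝ) (hd : ∀ z, d z ≠ 0) {s : Set (Fin n → ℝ)}
    (hs : MeasurableSet s) (g : (Fin n → ℝ) → ℝ) :
    ∫ t in (fun t => d * t + b) '' s, g t = |∏ z, d z| * ∫ t in s, g (d * t + b) := by
  set L : (Fin n → ℝ) →L[ℝ] (Fin n → ℝ) :=
    (Matrix.toLin' (Matrix.diagonal d)).toContinuousLinearMap with hL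
  have hLt : ∀ t, L t = d * t := by
    intro t
    ext z
    simp [hL, Matrix.mulVec_diagonal]
  have hdet : L.det = ∏ z, d z := by
    simp [hL, LinearMap.det_toContinuousLinearMap]
  have hf : ∀ t ∈ s, HasFDerivWithinAt (fun t => d * t + b) L s t := by
    intro t _
    have : (fun t => d * t + b) = fun t => L t + b := by
      funext t
      rw [hLt]
    rw [this]
    exact (L.hasFDerivAt.add_const b).hasFDerivWithinAt
  have hinj : Set.InjOn (fun t => d * t + b) s := by
    intro t _ t' _ h
    ext z
    have := congrFun h z
    simp only [Pi.add_apply, Pi.mul_apply, add_left_inj] at this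
    exact mul_left_cancel₀ (hd z) this
  rw [integral_image_eq_integral_abs_det_fderiv_smul volume hs hf hinj, hdet]
  simp [integral_const_mul]

lemma volume_real_image_mul_add (d b : Fin n → ℝ) (hd : ∀ z, d z ≠ 0) {s : Set (Fin n → ℝ)}
    (hs : MeasurableSet s) :
    volume.real ((fun t => d * t + b) '' s) = |∏ z, d z| * volume.real s := by
  have := setIntegral_image_mul_add d b hd hs (fun _ => 1)
  simpa using this

variable {T : Set (Fin n → ℝ)}

lemma integrableOn_coord (hT : IsCompact T) (y : Fin n) {s : Set (Fin n → ℝ)} (hs : s ⊆ T)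
    (a b : ℝ) : IntegrableOn (fun t => a * t y + b) s volume :=
  ((by fun_prop : Continuous fun t : Fin n → ℝ => a * t y + b).continuousOn.integrableOn_compact
    hT).mono_set hs

/-- Markov's inequality with the constant `1 / 2`, for a body that is downward closed in the
coordinate `y`. The part of `T` between heights `a` and `2 * a` is reflected into the part below
height `a`, which balances the two contributions to the first moment. -/
lemma two_mul_volume_lt_le_moment (hT : IsCompact T) (y : Fin n) (hpos : ∀ t ∈ T, 0 ≤ t y)
    (hlow : ∀ t ∈ T, ∀ s, 0 ≤ s → s ≤ t y → Function.update t y s ∈ T) (a : ℝ) :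
    2 * a * volume.real (T ∩ {t | a < t y}) ≤ ∫ t in T, t y := by
  set B := T ∩ {t | a < t y} with hB
  set B₁ := T ∩ {t | a < t y ∧ t y ≤ 2 * a} with hB₁
  set D := T ∩ {t | t y ≤ a} with hD
  have hTm := hT.measurableSet
  have hBm : MeasurableSet B :=
    hTm.inter (measurableSet_lt measurable_const (measurable_pi_apply y))
  have hB₁m : MeasurableSet B₁ :=
    hTm.inter ((measurableSet_lt measurable_const (measurable_pi_apply y)).inter
      (measurableSet_le (measurable_pi_apply y) measurable_const))
  have hDm : MeasurableSet D :=
    hTm.inter (measurableSet_le (measurable_pi_apply y) measurable_const)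
  have hint : ∀ s ⊆ T, IntegrableOn (fun t => t y) s volume := fun s hs => by
    simpa using integrableOn_coord hT y hs 1 0
  have hint' : ∀ s ⊆ T, IntegrableOn (fun t => 2 * a - t y) s volume := fun s hs => by
    simpa [sub_eq_neg_add] using integrableOn_coord hT y hs (-1) (2 * a)
  have hsplit : ∫ t in T, t y = (∫ t in D, t y) + ∫ t in B, t y := by
    have hU : T = D ∪ B := by
      ext t
      simp only [hD, hB, Set.mem_union, Set.mem_inter_iff, Set.mem_ofPred_eq]
      constructor
      · intro h
        rcases le_or_gt (t y) a with h' | h'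
        exacts [Or.inl ⟨h, h'⟩, Or.inr ⟨h, h'⟩]
      · rintro (h | h) <;> exact h.1
    have hdisj : Disjoint D B := by
      rw [Set.disjoint_left]
      rintro t ⟨_, h⟩ ⟨_, h'⟩
      exact absurd (show a < t y from h') (not_lt.2 h)
    conv_lhs => rw [hU]
    exact setIntegral_union hdisj hBm (hint _ Set.inter_subset_left)
      (hint _ Set.inter_subset_left)
  have hsub : B₁ ⊆ B := fun t ht => ⟨ht.1, ht.2.1⟩
  have h1 : ∫ t in B, (2 * a - t y) ≤ ∫ t in B₁, (2 * a - t y) := by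
    have hU : B = B₁ ∪ B \ B₁ := (Set.union_sdiff_cancel hsub).symm
    conv_lhs => rw [hU]
    rw [setIntegral_union Set.disjoint_sdiff_right (hBm.diff hB₁m)
      (hint' _ Set.inter_subset_left)
      (hint' _ (Set.sdiff_subset.trans Set.inter_subset_left))]
    have : ∫ t in B \ B₁, (2 * a - t y) ≤ 0 := by
      apply setIntegral_nonpos (hBm.diff hB₁m)
      rintro t ⟨ht, ht'⟩
      by_contra h
      exact ht' ⟨ht.1, ht.2, by linarith⟩
    linarith
  set d : Fin n → ℝ := Function.update 1 y (-1) with hd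
  set b : Fin n → ℝ := Pi.single y (2 * a) with hb
  have hmap : ∀ t, d * t + b = Function.update t y (2 * a - t y) := by
    intro t
    ext z
    rcases eq_or_ne z y with rfl | hz
    · simp [hd, hb]; ring
    · simp [hd, hb, hz]
  have hdne : ∀ z, d z ≠ 0 := by
    intro z
    rcases eq_or_ne z y with rfl | hz
    · simp [hd]
    · simp [hd, hz]
  have hprod : |∏ z, d z| = 1 := by
    rw [Finset.prod_update_of_mem (Finset.mem_univ y)]
    simp
  have h2 : ∫ t in B₁, (2 * a - t y) = ∫ t in (fun t => d * t + b) '' B₁, t y := by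
    rw [setIntegral_image_mul_add d b hdne hB₁m, hprod, one_mul]
    simp only [hmap, Function.update_self]
  have h3 : ∫ t in (fun t => d * t + b) '' B₁, t y ≤ ∫ t in D, t y := by
    apply setIntegral_mono_set (hint _ Set.inter_subset_left)
    · exact (ae_restrict_iff' hDm).2 (Filter.Eventually.of_forall fun t ht => hpos t ht.1)
    · apply Filter.Eventually.of_forall
      rintro _ ⟨t, ⟨ht, hlt, hle⟩, rfl⟩
      simp only [hmap]
      refine ⟨hlow t ht _ (by linarith) (by linarith), ?_⟩
      simp only [Set.mem_ofPred_eq, Function.update_self]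
      linarith
  have h4 : ∫ t in B, (2 * a - t y) = 2 * a * volume.real B - ∫ t in B, t y := by
    have hBfin : volume B ≠ ⊤ := (measure_mono Set.inter_subset_left).trans_lt
      hT.measure_lt_top |>.ne
    have hconst : IntegrableOn (fun _ : Fin n → ℝ => 2 * a) B volume :=
      integrableOn_const hBfin
    rw [integral_sub hconst (hint _ Set.inter_subset_left), setIntegral_const, smul_eq_mul,
      mul_comm]
  linarith

/-- The centroid of a convex body in the half-space `0 ≤ t y` has at least the fraction
`1 / (n + 1)` of the height of any of its points: shrink the body towards that point. -/
lemma mul_volume_le_moment (hT : IsCompact T) (hc : Convex ℝ T) (y : Fin n)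
    (hpos : ∀ t ∈ T, 0 ≤ t y) {p : Fin n → ℝ} (hp : p ∈ T) :
    p y * volume.real T ≤ (n + 1) * ∫ t in T, t y := by
  set I := ∫ t in T, t y with hI
  have hTm := hT.measurableSet
  have hI0 : 0 ≤ I := setIntegral_nonneg hTm hpos
  have key : ∀ θ : ℝ, 0 < θ → θ < 1 → (1 - θ) ^ n * (p y * volume.real T) ≤ (n + 1) * I := by
    intro θ h0 h1
    set d : Fin n → ℝ := fun _ => 1 - θ with hd
    have hne : ∀ z, d z ≠ 0 := fun z => by simp only [hd]; linarith
    have hprod : |∏ z, d z| = (1 - θ) ^ n := by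
      simp only [hd, Finset.prod_const, Finset.card_univ, Fintype.card_fin]
      exact abs_of_nonneg (pow_nonneg (by linarith) n)
    have himg : ∫ t in (fun t => d * t + θ • p) '' T, t y ≤ I := by
      apply setIntegral_mono_set (by simpa using integrableOn_coord hT y subset_rfl 1 0)
      · exact (ae_restrict_iff' hTm).2 (Filter.Eventually.of_forall hpos)
      · apply Filter.Eventually.of_forall
        rintro _ ⟨t, ht, rfl⟩
        have h := hc ht hp (sub_nonneg.2 h1.le) h0.le (sub_add_cancel 1 θ)
        exact h
    rw [setIntegral_image_mul_add d _ hne hTm, hprod] at himg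
    have hval : ∫ t in T, (d * t + θ • p) y = (1 - θ) * I + θ * p y * volume.real T := by
      have h1 : IntegrableOn (fun t : Fin n → ℝ => (1 - θ) * t y) T volume := by
        simpa using integrableOn_coord hT y subset_rfl (1 - θ) 0
      have h2 : IntegrableOn (fun _ : Fin n → ℝ => θ * p y) T volume := by
        simpa using integrableOn_coord hT y subset_rfl 0 (θ * p y)
      have := integral_add h1 h2
      simp only [Pi.add_apply, Pi.mul_apply, Pi.smul_apply, smul_eq_mul, hd]
      rw [this, integral_const_mul]
      simp [mul_comm, hI]
    rw [hval] at himg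
    have hbern : 1 - (n + 1) * θ ≤ (1 - θ) ^ (n + 1) := by
      have := one_add_mul_le_pow (a := -θ) (by linarith) (n + 1)
      push_cast at this
      calc 1 - (n + 1) * θ = 1 + (n + 1) * -θ := by ring
        _ ≤ _ := this
        _ = _ := by ring
    have h2 : θ * ((1 - θ) ^ n * (p y * volume.real T)) ≤ θ * ((n + 1) * I) := by
      have h3 := mul_le_mul_of_nonneg_right hbern hI0
      rw [pow_succ] at h3
      nlinarith
    exact le_of_mul_le_mul_left h2 h0
  have hlim : Filter.Tendsto (fun θ : ℝ => (1 - θ) ^ n * (p y * volume.real T))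
      (nhdsWithin 0 (Set.Ioi 0)) (nhds ((1 - 0) ^ n * (p y * volume.real T))) := by
    apply Filter.Tendsto.mono_left _ nhdsWithin_le_nhds
    exact (by fun_prop : Continuous fun θ : ℝ => (1 - θ) ^ n * (p y * volume.real T)).tendsto 0
  have := le_of_tendsto hlim (b := (n + 1) * I) (by
    filter_upwards [Ioo_mem_nhdsGT (zero_lt_one' ℝ)] with θ hθ using key θ hθ.1 hθ.2)
  simpa using this

end Volume

/-! ### Uniform distributions on sets in coordinate flats -/

section Fatten

variable {n : ℕ}

/-- For a set `S` in the flat through `l` spanned by the coordinates in `A`: the translate of `S`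
by `-l`, thickened by the interval `[0, lam]` in every coordinate outside `A`. This replaces a set
of varying dimension by one of full dimension. -/
def fatten (S : Set (Fin n → ℝ)) (l : Fin n → ℝ) (A : Set (Fin n)) (lam : ℝ) :
    Set (Fin n → ℝ) :=
  {t | (∀ z ∉ A, 0 ≤ t z ∧ t z ≤ lam) ∧ l + A.indicator t ∈ S}

lemma vectorSpan_eq_range_extendByZero {S : Set (Fin n → ℝ)} {l : Fin n → ℝ} {A : Set (Fin n)}
    (hl : l ∈ S) (hflat : ∀ s ∈ S, ∀ z ∉ A, s z = l z)
    (hdir : ∀ z ∈ A, ∃ r : ℝ, r ≠ 0 ∧ l + Pi.single z r ∈ S) :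
    vectorSpan ℝ S =
      LinearMap.range (Function.ExtendByZero.linearMap ℝ (Subtype.val : A → Fin n)) := by
  classical
  apply le_antisymm
  · rw [vectorSpan_def, Submodule.span_le]
    rintro _ ⟨s, hs, s', hs', rfl⟩
    refine ⟨fun z => s z - s' z, ?_⟩
    ext z
    by_cases hz : z ∈ A
    · have := Subtype.val_injective.extend_apply (fun z : A => s z - s' z) 0 ⟨z, hz⟩
      simpa using this
    · have : ¬ ∃ a : A, a.1 = z := by
        rintro ⟨a, rfl⟩
        exact hz a.2
      simp [Function.extend_apply' _ _ _ this, hflat s hs z hz, hflat s' hs' z hz]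
  · rintro _ ⟨f, rfl⟩
    have hsum : Function.ExtendByZero.linearMap ℝ (Subtype.val : A → Fin n) f =
        ∑ z : A, f z • Pi.single (M := fun _ => ℝ) z.1 1 := by
      ext w
      rw [Finset.sum_apply]
      by_cases hw : w ∈ A
      · have := Subtype.val_injective.extend_apply f 0 ⟨w, hw⟩
        rw [Finset.sum_eq_single ⟨w, hw⟩]
        · simpa using this
        · intro b _ hb
          have : w ≠ b.1 := fun h => hb (Subtype.ext h.symm)
          simp [this]
        · simp
      · have h1 : ¬ ∃ a : A, a.1 = w := by
          rintro ⟨a, rfl⟩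
          exact hw a.2
        rw [Finset.sum_eq_zero]
        · simp [Function.extend_apply' _ _ _ h1]
        · intro b _
          have : w ≠ b.1 := fun h => h1 ⟨b, h.symm⟩
          simp [this]
    rw [hsum]
    refine Submodule.sum_mem _ fun z _ => Submodule.smul_mem _ _ ?_
    obtain ⟨r, hr, hrS⟩ := hdir z.1 z.2
    have hmem := vsub_mem_vectorSpan ℝ hrS hl
    have : Pi.single (M := fun _ => ℝ) z.1 1 = r⁻¹ • ((l + Pi.single z.1 r) -ᵥ l) := by
      ext w
      rcases eq_or_ne w z.1 with rfl | hw
      · simp [hr]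
      · simp [hw]
    rw [this]
    exact Submodule.smul_mem _ _ hmem

lemma isometry_add_extend (l : Fin n → ℝ) (A : Set (Fin n)) [Fintype A] :
    Isometry (fun f : A → ℝ => l + Function.extend Subtype.val f 0) := by
  classical
  refine Isometry.of_dist_eq fun f g => ?_
  rw [dist_add_left]
  apply le_antisymm
  · refine (dist_pi_le_iff dist_nonneg).2 fun z => ?_
    by_cases hz : z ∈ A
    · have h1 := Subtype.val_injective.extend_apply f 0 ⟨z, hz⟩
      have h2 := Subtype.val_injective.extend_apply g 0 ⟨z, hz⟩
      simp only at h1 h2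
      rw [h1, h2]
      exact dist_le_pi_dist f g ⟨z, hz⟩
    · have h1 : ¬ ∃ a : A, a.1 = z := by
        rintro ⟨a, rfl⟩
        exact hz a.2
      rw [Function.extend_apply' _ _ _ h1, Function.extend_apply' _ _ _ h1, dist_self]
      exact dist_nonneg
  · refine (dist_pi_le_iff dist_nonneg).2 fun z => ?_
    have := dist_le_pi_dist (Function.extend Subtype.val f (0 : Fin n → ℝ))
      (Function.extend Subtype.val g 0) z.1
    rwa [Subtype.val_injective.extend_apply, Subtype.val_injective.extend_apply] at this

/-- The uniform distribution on a set in a coordinate flat is the image of the uniform distribution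
on its full-dimensional thickening. -/
lemma unif_eq_map_cond_fatten {S : Set (Fin n → ℝ)} {l : Fin n → ℝ} {A : Set (Fin n)} {lam : ℝ}
    (hS : MeasurableSet S) (hlam : 0 < lam)
    (hl : l ∈ S) (hflat : ∀ s ∈ S, ∀ z ∉ A, s z = l z)
    (hdir : ∀ z ∈ A, ∃ r : ℝ, r ≠ 0 ∧ l + Pi.single z r ∈ S) :
    unif S = Measure.map (fun t => l + A.indicator t) (cond volume (fatten S l A lam)) := by
  classical
  set φ : (A → ℝ) → (Fin n → ℝ) := fun f => l + Function.extend Subtype.val f 0 with hφ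
  have hiso : Isometry φ := isometry_add_extend l A
  have hφm : Measurable φ := hiso.continuous.measurable
  have hrank : (Module.finrank ℝ (vectorSpan ℝ S) : ℝ) = Fintype.card A := by
    rw [vectorSpan_eq_range_extendByZero hl hflat hdir, LinearMap.finrank_range_of_inj,
      Module.finrank_fintype_fun_eq_card]
    exact Function.extend_injective (γ := ℝ) (Subtype.val_injective (p := (· ∈ A)))
      (0 : Fin n → ℝ)
  set P := φ ⁻¹' S with hP
  have hPm : MeasurableSet P := hφm hS
  have hsub : S ⊆ Set.range φ := by
    intro s hs
    refine ⟨fun z => s z - l z, ?_⟩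
    ext z
    by_cases hz : z ∈ A
    · have := Subtype.val_injective.extend_apply (fun z : A => s z - l z) 0 ⟨z, hz⟩
      simp only at this
      simp [hφ, this]
    · have h1 : ¬ ∃ a : A, a.1 = z := by
        rintro ⟨a, rfl⟩
        exact hz a.2
      simp [hφ, Function.extend_apply' _ _ _ h1, hflat s hs z hz]
  have hrestr : (Measure.hausdorffMeasure (Fintype.card A : ℝ)).restrict S =
      Measure.map φ (volume.restrict P) := by
    rw [← hausdorffMeasure_pi_real, hP, ← Measure.restrict_map hφm hS,
      hiso.map_hausdorffMeasure (Or.inl (Nat.cast_nonneg _)), Measure.restrict_restrict hS,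
      Set.inter_eq_left.2 hsub]
  have hmass : Measure.hausdorffMeasure (Fintype.card A : ℝ) S = volume P := by
    have := congrArg (fun μ => μ Set.univ) hrestr
    simpa [Measure.map_apply hφm MeasurableSet.univ] using this
  set e := MeasurableEquiv.piEquivPiSubtypeProd (fun _ : Fin n => ℝ) (fun z => z ∈ A) with he
  set box : Set ({z // z ∉ A} → ℝ) := Set.univ.pi fun _ => Set.Icc 0 lam with hbox
  have hboxm : MeasurableSet box := MeasurableSet.univ_pi fun _ => measurableSet_Icc
  have hbox0 : volume box ≠ 0 := by
    rw [hbox, volume_pi_pi]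
    simp [hlam]
  have hboxt : volume box ≠ ⊤ := by
    rw [hbox, volume_pi_pi]
    exact ENNReal.prod_ne_top fun z _ => by simp
  have hcomp : ∀ t : Fin n → ℝ, φ (e t).1 = l + A.indicator t := by
    intro t
    ext z
    by_cases hz : z ∈ A
    · have := Subtype.val_injective.extend_apply (e t).1 0 ⟨z, hz⟩
      rw [Pi.add_apply, Set.indicator_of_mem hz]
      exact congrArg (l z + ·) this
    · have h1 : ¬ ∃ a : A, a.1 = z := by
        rintro ⟨a, rfl⟩
        exact hz a.2
      simp [hφ, hz]
  have hfat : fatten S l A lam = e ⁻¹' (P ×ˢ box) := by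
    ext t
    simp only [fatten, Set.mem_ofPred_eq, Set.mem_preimage, Set.mem_prod, hP, hcomp, hbox,
      Set.mem_pi, Set.mem_univ, true_imp_iff, Set.mem_Icc, Subtype.forall]
    exact and_comm
  have hemp : MeasurePreserving e := volume_preserving_piEquivPiSubtypeProd _ _
  have hmapfat : Measure.map (fun t => l + A.indicator t) (volume.restrict (fatten S l A lam)) =
      volume box • Measure.map φ (volume.restrict P) := by
    have h1 : (fun t => l + A.indicator t) = φ ∘ Prod.fst ∘ e := by
      funext t
      exact (hcomp t).symm
    rw [h1, ← Measure.map_map hφm (measurable_fst.comp e.measurable),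
      ← Measure.map_map measurable_fst e.measurable, hfat,
      ← Measure.restrict_map e.measurable (hPm.prod hboxm), hemp.map_eq,
      Measure.volume_eq_prod, ← Measure.prod_restrict, Measure.map_fst_prod,
      Measure.map_smul, Measure.restrict_apply_univ]
  have hvol : volume (fatten S l A lam) = volume P * volume box := by
    rw [hfat, hemp.measure_preimage (hPm.prod hboxm).nullMeasurableSet, Measure.volume_eq_prod,
      Measure.prod_prod]
  rw [unif, hrank, ProbabilityTheory.cond, ProbabilityTheory.cond, hmass, hrestr,
    Measure.map_smul, hmapfat, hvol, smul_smul,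
    ENNReal.mul_inv (Or.inr hboxt) (Or.inr hbox0), mul_assoc,
    ENNReal.inv_mul_cancel hbox0 hboxt, mul_one]

end Fatten

/-! ### Search regions and their centroids -/

section Region

variable {n : ℕ}

/-- The strategies in `X` between the entry-wise bounds `l` and `h`. -/
def region (X : Set (Fin n → ℝ)) (l h : Fin n → ℝ) : Set (Fin n → ℝ) :=
  {x' | x' ∈ X ∧ l ≤ x' ∧ x' ≤ h}

variable (G : SecurityGame n) {l h : Fin n → ℝ} {A : Set (Fin n)} {lam : ℝ}

lemma mem_of_le {x x' : Fin n → ℝ} (hx : x ∈ G.X) (h0 : 0 ≤ x') (hle : x' ≤ x) : x' ∈ G.X :=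
  G.downwardClosed x hx x' ⟨h0, hle.trans (G.subset_cube hx).2⟩ hle

lemma isClosed_region : IsClosed (region G.X l h) :=
  G.isClosed.inter (isClosed_Ici.inter isClosed_Iic)

lemma convex_region : Convex ℝ (region G.X l h) :=
  G.convex.inter ((convex_Ici l).inter (convex_Iic h))

lemma continuous_add_indicator (l : Fin n → ℝ) (A : Set (Fin n)) :
    Continuous fun t : Fin n → ℝ => l + A.indicator t := by
  classical
  refine continuous_const.add (continuous_pi fun z => ?_)
  by_cases hz : z ∈ A
  · simpa [hz] using continuous_apply z
  · simpa [hz] using continuous_const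

lemma fatten_region_nonneg {t : Fin n → ℝ} (ht : t ∈ fatten (region G.X l h) l A lam) :
    0 ≤ t := by
  intro z
  by_cases hz : z ∈ A
  · have := ht.2.2.1 z
    simpa [hz] using this
  · exact (ht.1 z hz).1

lemma isCompact_fatten_region : IsCompact (fatten (region G.X l h) l A lam) := by
  have hclosed : IsClosed (fatten (region G.X l h) l A lam) := by
    apply IsClosed.inter
    · have : {t : Fin n → ℝ | ∀ z ∉ A, 0 ≤ t z ∧ t z ≤ lam} =
          ⋂ z, ⋂ (_ : z ∉ A), {t | 0 ≤ t z ∧ t z ≤ lam} := by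
        ext t
        simp
      change IsClosed {t : Fin n → ℝ | ∀ z ∉ A, 0 ≤ t z ∧ t z ≤ lam}
      rw [this]
      exact isClosed_iInter fun z => isClosed_iInter fun _ =>
        (isClosed_le continuous_const (continuous_apply z)).inter
          (isClosed_le (continuous_apply z) continuous_const)
    · exact (isClosed_region G).preimage (continuous_add_indicator l A)
  refine (isCompact_Icc (a := (0 : Fin n → ℝ))
    (b := fun z => max lam (1 - l z))).of_isClosed_subset hclosed fun t ht => ?_
  refine ⟨fatten_region_nonneg G ht, fun z => ?_⟩
  by_cases hz : z ∈ A
  · have := (G.subset_cube ht.2.1).2 z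
    simp only [Pi.add_apply, Set.indicator_of_mem hz, Pi.one_apply] at this
    exact le_max_of_le_right (by linarith)
  · exact le_max_of_le_left (ht.1 z hz).2

lemma convex_fatten_region : Convex ℝ (fatten (region G.X l h) l A lam) := by
  intro t ht t' ht' a b ha hb hab
  refine ⟨fun z hz => ?_, ?_⟩
  · obtain ⟨h1, h2⟩ := ht.1 z hz
    obtain ⟨h3, h4⟩ := ht'.1 z hz
    have := (convex_Icc (0 : ℝ) lam) (x := t z) ⟨h1, h2⟩ (y := t' z) ⟨h3, h4⟩ ha hb hab
    exact this
  · have := convex_region G ht.2 ht'.2 ha hb hab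
    convert this using 1
    ext z
    by_cases hz : z ∈ A
    · simp [hz]
      linear_combination - l z * hab
    · simp [hz]
      linear_combination - l z * hab

lemma fatten_region_of_le (hl : 0 ≤ l) {t t' : Fin n → ℝ}
    (ht : t ∈ fatten (region G.X l h) l A lam) (h0 : 0 ≤ t') (hle : t' ≤ t) :
    t' ∈ fatten (region G.X l h) l A lam := by
  have h1 : l ≤ l + A.indicator t' := by
    intro z
    by_cases hz : z ∈ A
    · simpa [hz] using h0 z
    · simp [hz]
  have h2 : l + A.indicator t' ≤ l + A.indicator t := by
    intro z
    by_cases hz : z ∈ A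
    · simpa [hz] using hle z
    · simp [hz]
  exact ⟨fun z hz => ⟨h0 z, (hle z).trans (ht.1 z hz).2⟩,
    mem_of_le G ht.2.1 (hl.trans h1) h2, h1, h2.trans ht.2.2.2⟩

/-- The thickened region contains the box below the average of its extreme points along the
coordinate axes. -/
lemma prod_le_volume_fatten_region [NeZero n] (hl : l ∈ G.X) (hlh : l ≤ h) (hlam : 0 ≤ lam)
    {r : Fin n → ℝ} (hr : ∀ z ∈ A, l + Pi.single z (r z) ∈ region G.X l h) (p : Fin n → ℝ)
    (hp0 : 0 ≤ p) (hpA : ∀ z ∈ A, p z ≤ r z / n) (hpc : ∀ z ∉ A, p z ≤ lam) :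
    ∏ z, p z ≤ volume.real (fatten (region G.X l h) l A lam) := by
  classical
  have hn : (0 : ℝ) < n := Nat.cast_pos.2 (Nat.pos_of_ne_zero (NeZero.ne n))
  set q : Fin n → Fin n → ℝ := fun z w =>
    if w ∈ A then (if w = z then r z else 0) else lam with hq
  have hqT : ∀ z, q z ∈ fatten (region G.X l h) l A lam := by
    intro z
    refine ⟨fun w hw => by simp [hq, hw, hlam], ?_⟩
    by_cases hz : z ∈ A
    · convert hr z hz using 2
      ext w
      by_cases hw : w ∈ A
      · rcases eq_or_ne w z with rfl | hwz
        · simp [hq, hw]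
        · simp [hq, hw, hwz]
      · have : w ≠ z := fun h => hw (h ▸ hz)
        simp [hw, this]
    · have : l + A.indicator (q z) = l := by
        ext w
        by_cases hw : w ∈ A
        · have : w ≠ z := fun h => hz (h ▸ hw)
          simp [hq, hw, this]
        · simp [hw]
      rw [this]
      exact ⟨hl, le_rfl, hlh⟩
  have hmean : ∑ z, (1 / n : ℝ) • q z ∈ fatten (region G.X l h) l A lam := by
    refine (convex_fatten_region G).sum_mem (fun _ _ => by positivity) ?_ fun z _ => hqT z
    simp [hn.ne']
  have hpT : Set.Icc 0 p ⊆ fatten (region G.X l h) l A lam := by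
    rintro t ⟨ht0, htp⟩
    refine fatten_region_of_le G (G.subset_cube hl).1 hmean ht0 (htp.trans fun w => ?_)
    rw [Finset.sum_apply]
    by_cases hw : w ∈ A
    · have : ∀ z, ((1 / n : ℝ) • q z) w = if w = z then r w / n else 0 := by
        intro z
        rcases eq_or_ne w z with rfl | hwz
        · simp [hq, hw, div_eq_inv_mul]
        · simp [hq, hw, hwz]
      simp only [this]
      simpa using hpA w hw
    · have : ∀ z, ((1 / n : ℝ) • q z) w = lam / n := by
        intro z
        simp [hq, hw, div_eq_inv_mul]
      simp only [this, Finset.sum_const, Finset.card_univ, Fintype.card_fin, nsmul_eq_mul]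
      rw [mul_div_cancel₀ _ hn.ne']
      exact hpc w hw
  have hbox : volume.real (Set.Icc 0 p) = ∏ z, p z := by
    rw [Measure.real, Real.volume_Icc_pi_toReal hp0]
    simp
  rw [← hbox]
  exact measureReal_mono hpT (isCompact_fatten_region G).measure_lt_top.ne

lemma volume_fatten_region_pos [NeZero n] (hl : l ∈ G.X) (hlh : l ≤ h) (hlam : 0 < lam)
    (hr : ∀ z ∈ A, ∃ r : ℝ, 0 < r ∧ l + Pi.single z r ∈ region G.X l h) :
    0 < volume.real (fatten (region G.X l h) l A lam) := by
  classical
  have hn : (0 : ℝ) < n := Nat.cast_pos.2 (Nat.pos_of_ne_zero (NeZero.ne n))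
  choose! r hr0 hrS using hr
  have hp : ∀ z, 0 < if z ∈ A then r z / n else lam := by
    intro z
    split_ifs with hz
    · exact div_pos (hr0 z hz) hn
    · exact hlam
  refine lt_of_lt_of_le ?_ (prod_le_volume_fatten_region G hl hlh hlam.le
    hrS (fun z => if z ∈ A then r z / n else lam)
    (fun z => (hp z).le) (fun z hz => by simp [hz]) (fun z hz => by simp [hz]))
  exact Finset.prod_pos fun z _ => hp z


lemma isProbabilityMeasure_cond_fatten [NeZero n] (hl : l ∈ G.X) (hlh : l ≤ h) (hlam : 0 < lam)
    (hr : ∀ z ∈ A, ∃ r : ℝ, 0 < r ∧ l + Pi.single z r ∈ region G.X l h) :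
    IsProbabilityMeasure (ProbabilityTheory.cond volume (fatten (region G.X l h) l A lam)) := by
  refine cond_isProbabilityMeasure_of_finite ?_ (isCompact_fatten_region G).measure_lt_top.ne
  intro h0
  have := volume_fatten_region_pos G hl hlh hlam hr
  simp [Measure.real, h0] at this

lemma integrable_cond_of_continuous {T : Set (Fin n → ℝ)} (hT : IsCompact T)
    {E : Type*} [NormedAddCommGroup E] {f : (Fin n → ℝ) → E} (hf : Continuous f)
    (h0 : volume T ≠ 0) :
    Integrable f (ProbabilityTheory.cond volume T) :=
  (hf.continuousOn.integrableOn_compact hT).smul_measure (ENNReal.inv_ne_top.2 h0)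

lemma unif_region_eq [NeZero n] (hl : l ∈ G.X) (hlh : l ≤ h) (hlam : 0 < lam)
    (hflat : ∀ s ∈ region G.X l h, ∀ z ∉ A, s z = l z)
    (hr : ∀ z ∈ A, ∃ r : ℝ, 0 < r ∧ l + Pi.single z r ∈ region G.X l h) :
    unif (region G.X l h) = Measure.map (fun t => l + A.indicator t)
      (ProbabilityTheory.cond volume (fatten (region G.X l h) l A lam)) :=
  unif_eq_map_cond_fatten (isClosed_region G).measurableSet hlam ⟨hl, le_rfl, hlh⟩ hflat
    fun z hz => (hr z hz).imp fun _ h => ⟨h.1.ne', h.2⟩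

/-- The centroid lies in the region. The free coordinates are those in which some point of the
region differs from `l`. -/
lemma centroid_mem_region [NeZero n] (hl : l ∈ G.X) (hlh : l ≤ h) :
    centroid (region G.X l h) ∈ region G.X l h := by
  classical
  set A : Set (Fin n) := {z | ∃ s ∈ region G.X l h, s z ≠ l z} with hA
  have hflat : ∀ s ∈ region G.X l h, ∀ z ∉ A, s z = l z := by
    intro s hs z hz
    by_contra hne
    exact hz ⟨s, hs, hne⟩
  have hr : ∀ z ∈ A, ∃ r : ℝ, 0 < r ∧ l + Pi.single z r ∈ region G.X l h := by
    rintro z ⟨s, hs, hne⟩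
    have hlt : l z < s z := lt_of_le_of_ne (hs.2.1 z) (Ne.symm hne)
    have h1 : l ≤ l + Pi.single z (s z - l z) := by
      intro w
      rcases eq_or_ne w z with rfl | hw
      · simp [hlt.le]
      · simp [hw]
    have h2 : l + Pi.single z (s z - l z) ≤ s := by
      intro w
      rcases eq_or_ne w z with rfl | hw
      · simp
      · simpa [hw] using hs.2.1 w
    exact ⟨s z - l z, sub_pos.2 hlt,
      mem_of_le G hs.1 ((G.subset_cube hl).1.trans h1) h2, h1, h2.trans hs.2.2⟩
  have hprob := isProbabilityMeasure_cond_fatten G hl hlh one_pos hr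
  have hvol := volume_fatten_region_pos G hl hlh one_pos hr
  have hcont := continuous_add_indicator l A
  rw [centroid, unif_region_eq G hl hlh one_pos hflat hr,
    integral_map hcont.measurable.aemeasurable (by fun_prop)]
  refine (convex_region G).integral_mem (isClosed_region G) ?_
    (integrable_cond_of_continuous (isCompact_fatten_region G) hcont
      fun h0 => by simp [Measure.real, h0] at hvol)
  filter_upwards [ae_cond_mem (μ := volume)
    (isCompact_fatten_region G (l := l) (h := h) (A := A) (lam := 1)).measurableSet] with t ht
  exact ht.2

lemma volume_mul_centroid_sub [NeZero n] (hl : l ∈ G.X) (hlh : l ≤ h) (hlam : 0 < lam)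
    (hflat : ∀ s ∈ region G.X l h, ∀ z ∉ A, s z = l z)
    (hr : ∀ z ∈ A, ∃ r : ℝ, 0 < r ∧ l + Pi.single z r ∈ region G.X l h) {y : Fin n}
    (hy : y ∈ A) :
    volume.real (fatten (region G.X l h) l A lam) * (centroid (region G.X l h) y - l y) =
      ∫ t in fatten (region G.X l h) l A lam, t y := by
  classical
  set T := fatten (region G.X l h) l A lam with hT
  have hTc : IsCompact T := isCompact_fatten_region G
  have hprob := isProbabilityMeasure_cond_fatten G hl hlh hlam hr
  have hvol := volume_fatten_region_pos G hl hlh hlam hr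
  rw [← hT] at hprob hvol
  have hcont := continuous_add_indicator l A
  have h0 : volume T ≠ 0 := fun h0 => by simp [Measure.real, h0] at hvol
  have hc : centroid (region G.X l h) y = ∫ t, (l y + t y) ∂(ProbabilityTheory.cond volume T) := by
    rw [centroid, unif_region_eq G hl hlh hlam hflat hr,
      integral_map hcont.measurable.aemeasurable (by fun_prop), eval_integral]
    · simp [hy, hT]
    · intro i
      exact integrable_cond_of_continuous hTc ((continuous_apply i).comp hcont) h0
  have hint : Integrable (fun t : Fin n → ℝ => t y) (ProbabilityTheory.cond volume T) :=
    integrable_cond_of_continuous hTc (continuous_apply y) h0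
  rw [hc, integral_add (integrable_const _) hint, integral_const, probReal_univ, one_smul,
    add_sub_cancel_left, ProbabilityTheory.cond, integral_smul_measure, ENNReal.toReal_inv,
    smul_eq_mul]
  exact mul_inv_cancel_left₀ hvol.ne' _

end Region

/-! ### Volume decrease in one round -/

section Cut

variable {n : ℕ} (G : SecurityGame n) {l h : Fin n → ℝ} {A : Set (Fin n)} {lam : ℝ}

/-- In a free direction, in which the region has width at least `lam`, the centroid lies at height
at least `lam / (n + 1)`. -/
lemma div_le_centroid_sub [NeZero n] (hl : l ∈ G.X) (hlh : l ≤ h) (hlam : 0 < lam)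
    (hflat : ∀ z ∉ A, h z = l z)
    (hr : ∀ z ∈ A, l + Pi.single z lam ∈ region G.X l h) {y : Fin n} (hy : y ∈ A) :
    lam / (n + 1) ≤ centroid (region G.X l h) y - l y := by
  have hflat' : ∀ s ∈ region G.X l h, ∀ z ∉ A, s z = l z := fun s hs z hz =>
    le_antisymm ((hs.2.2 z).trans (hflat z hz).le) (hs.2.1 z)
  have hr' : ∀ z ∈ A, ∃ r : ℝ, 0 < r ∧ l + Pi.single z r ∈ region G.X l h :=
    fun z hz => ⟨lam, hlam, hr z hz⟩
  have hmom := volume_mul_centroid_sub G hl hlh hlam hflat' hr' hy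
  have hvol := volume_fatten_region_pos G hl hlh hlam hr'
  have hp : Pi.single y lam ∈ fatten (region G.X l h) l A lam := by
    refine ⟨fun z hz => ?_, ?_⟩
    · have : z ≠ y := fun h => hz (h ▸ hy)
      simp [this, hlam.le]
    · convert hr y hy using 2
      ext w
      by_cases hw : w ∈ A
      · simp [hw]
      · have : w ≠ y := fun h => hw (h ▸ hy)
        simp [hw, this]
  have hlow := mul_volume_le_moment (isCompact_fatten_region G) (convex_fatten_region G) y
    (fun t ht => fatten_region_nonneg G ht y) hp
  rw [← hmom, Pi.single_eq_same] at hlow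
  rw [div_le_iff₀ (by positivity)]
  refine le_of_mul_le_mul_right ?_ hvol
  linarith

/-- The potential `volume * (33 * n ^ 2) ^ (number of free coordinates)` of the thickened region
drops by a constant factor when the region is cut `η` below its centroid in a free direction `y`
and some coordinates are locked.

The cut alone is handled by `two_mul_volume_lt_le_moment`. For the locking, let `A'` be the set of
coordinates which stay free. The new body is mapped into the part of the old one above the cut by
an affine map which shrinks the coordinates in `A'` by `1 - θ` and those in `A \ A'` by a factor
of order `1 / n ^ 2`. This uses convexity, and that the old region contains its centroid, which
has all free coordinates at least `η` above the cut. With `θ = 1 / (2 * n)`, the coordinates in `A'`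
cost only a factor of `2` in total. -/
lemma volume_fatten_cut [NeZero n] (hl : l ∈ G.X) (hlh : l ≤ h) (hlam : 0 < lam)
    (hflat : ∀ z ∉ A, h z = l z)
    (hr : ∀ z ∈ A, l + Pi.single z lam ∈ region G.X l h) {y : Fin n} (hy : y ∈ A)
    {η : ℝ} (hη : η = 4 * lam / (33 * n)) {l' h' : Fin n → ℝ} {A' : Set (Fin n)}
    (hl' : l' = Function.update l y (centroid (region G.X l h) y - η))
    (hA' : A' ⊆ A) (hh' : ∀ z ∈ A', h' z ≤ h z) :
    volume.real (fatten (region G.X l' h') l' A' lam) * (33 * (n : ℝ) ^ 2) ^ A'.ncard ≤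
      11 / 16 * (volume.real (fatten (region G.X l h) l A lam) *
        (33 * (n : ℝ) ^ 2) ^ A.ncard) := by
  classical
  have hn : (1 : ℝ) ≤ n := Nat.one_le_cast.2 (Nat.pos_of_ne_zero (NeZero.ne n))
  set x := centroid (region G.X l h) with hx
  have hxS : x ∈ region G.X l h := centroid_mem_region G hl hlh
  have hflat' : ∀ s ∈ region G.X l h, ∀ z ∉ A, s z = l z := fun s hs z hz =>
    le_antisymm ((hs.2.2 z).trans (hflat z hz).le) (hs.2.1 z)
  have hr' : ∀ z ∈ A, ∃ r : ℝ, 0 < r ∧ l + Pi.single z r ∈ region G.X l h :=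
    fun z hz => ⟨lam, hlam, hr z hz⟩
  set T := fatten (region G.X l h) l A lam with hT
  set T' := fatten (region G.X l' h') l' A' lam with hT'
  have hTc : IsCompact T := isCompact_fatten_region G
  have hT'c : IsCompact T' := isCompact_fatten_region G
  have hl0 : 0 ≤ l := (G.subset_cube hl).1
  have hη0 : 0 < η := by rw [hη]; positivity
  have hηlam : η ≤ lam / (n + 1) * (8 / 33) := by
    rw [hη, div_mul_div_comm, div_le_div_iff₀ (by positivity) (by positivity)]
    nlinarith [mul_pos hlam (by positivity : (0 : ℝ) < n)]
  have hcz : ∀ z ∈ A, lam / (n + 1) ≤ x z - l z := fun z hz =>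
    div_le_centroid_sub G hl hlh hlam hflat hr hz
  have hηx : ∀ z ∈ A, η ≤ 8 / 33 * (x z - l z) := fun z hz => by
    linarith [hcz z hz]
  set c := x y - l y with hc
  have hc0 : 0 < c := (div_pos hlam (by positivity)).trans_le (hcz y hy)
  set a := c - η with ha
  have ha_gt : 8 / 11 * c < a := by
    have := hηx y hy
    linarith
  have ha0 : 0 < a := lt_trans (by positivity) ha_gt
  have hl'y : l' y = l y + a := by
    rw [hl', Function.update_self]
    simp only [ha, hc]
    ring
  have hl'z : ∀ z ≠ y, l' z = l z := fun z hz => by rw [hl', Function.update_of_ne hz]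
  have hll' : l ≤ l' := by
    intro z
    rcases eq_or_ne z y with rfl | hz
    · linarith
    · exact (hl'z z hz).ge
  have hl'x : ∀ z ∈ A, l' z + η ≤ x z := by
    intro z hz
    rcases eq_or_ne z y with rfl | hzy
    · rw [hl'y]
      simp only [ha, hc]
      linarith
    · rw [hl'z z hzy]
      have := hηx z hz
      linarith
  have hl'x0 : l' ≤ x := by
    intro z
    by_cases hz : z ∈ A
    · linarith [hl'x z hz]
    · have : z ≠ y := fun h => hz (h ▸ hy)
      rw [hl'z z this]
      exact hxS.2.1 z
  -- the cut
  have hcut : volume.real (T ∩ {t | 8 / 11 * c < t y}) ≤ 11 / 16 * volume.real T := by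
    have h1 := two_mul_volume_lt_le_moment hTc y (fun t ht => fatten_region_nonneg G ht y)
      (fun t ht s hs0 hs => fatten_region_of_le G hl0 ht
        (by
          intro z
          rcases eq_or_ne z y with rfl | hz
          · simpa using hs0
          · simpa [hz] using fatten_region_nonneg G ht z)
        (by
          intro z
          rcases eq_or_ne z y with rfl | hz
          · simpa using hs
          · simp [hz])) (8 / 11 * c)
    rw [← volume_mul_centroid_sub G hl hlh hlam hflat' hr' hy] at h1
    refine le_of_mul_le_mul_left ?_ hc0
    have h2 : centroid (region G.X l h) y - l y = c := rfl
    rw [h2] at h1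
    linarith
  -- the affine map which accounts for the locked coordinates
  set L := A \ A' with hL
  set θ : ℝ := if L = ∅ then 0 else 1 / (2 * n) with hθ
  have hθ0 : 0 ≤ θ := by
    rw [hθ]; split_ifs <;> positivity
  have hθ1 : θ ≤ 1 / 2 := by
    rw [hθ]
    split_ifs
    · norm_num
    · exact one_div_le_one_div_of_le two_pos (by linarith)
  have hθn : (1 / 2 : ℝ) ≤ (1 - θ) ^ n := by
    have h1 := one_add_mul_le_pow (a := -θ) (by linarith) n
    have h2 : n * θ ≤ 1 / 2 := by
      rw [hθ]
      split_ifs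
      · simp
      · rw [mul_one_div, div_le_iff₀ (by positivity)]
        linarith
    calc (1 / 2 : ℝ) ≤ 1 + n * -θ := by linarith
      _ ≤ _ := h1
      _ = _ := by ring
  set κ : ℝ := θ * (η / lam) with hκ
  have hκ0 : 0 ≤ κ := by positivity
  have hκ1 : κ ≤ 1 := by
    have : η / lam ≤ 1 := by
      rw [div_le_one hlam, hη, div_le_iff₀ (by positivity)]
      nlinarith
    calc κ ≤ 1 * 1 := mul_le_mul (by linarith) this (by positivity) one_pos.le
      _ = 1 := one_mul 1
  set d : Fin n → ℝ := fun z => if z ∈ A' then 1 - θ else if z ∈ A then κ else 1 with hd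
  have hd0 : ∀ z, 0 < d z := by
    intro z
    simp only [hd]
    split_ifs with h1 h2
    · linarith
    · have : L ≠ ∅ := Set.Nonempty.ne_empty ⟨z, h2, h1⟩
      have : 0 < θ := by
        rw [hθ, if_neg this]; positivity
      positivity
    · exact one_pos
  have hdprod : 1 ≤ (∏ z, d z) * (33 * (n : ℝ) ^ 2) ^ L.ncard := by
    rcases Set.eq_empty_or_nonempty L with h0 | h0
    · have : ∀ z, d z = 1 := by
        intro z
        simp only [hd, hθ, if_pos h0]
        split_ifs with h1 h2
        · simp
        · exact absurd (show z ∈ L from ⟨h2, h1⟩) (by simp [h0])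
        · rfl
      simp [this, h0]
    · have hne : L ≠ ∅ := h0.ne_empty
      have hκv : κ = 2 / (33 * (n : ℝ) ^ 2) := by
        simp only [hκ, hθ, if_neg hne, hη]
        field_simp
        norm_num
      have h1 : ∏ z, ((1 - θ) * if z ∈ L then κ else 1) ≤ ∏ z, d z := by
        refine Finset.prod_le_prod (fun z _ => ?_) fun z _ => ?_
        · have : 0 ≤ 1 - θ := by linarith
          split_ifs <;> positivity
        · simp only [hd, hL, Set.mem_sdiff]
          by_cases hz' : z ∈ A'
          · simp [hz']
          · by_cases hz : z ∈ A
            · simp only [hz, hz', not_false_eq_true, and_self, if_true, if_false]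
              exact mul_le_of_le_one_left hκ0 (by linarith)
            · simp [hz, hz', hθ0]
      have h2 : ∏ z, ((1 - θ) * if z ∈ L then κ else 1) = (1 - θ) ^ n * κ ^ L.ncard := by
        rw [Finset.prod_mul_distrib, Finset.prod_ite, Finset.prod_const_one, mul_one,
          Finset.prod_const, Finset.prod_const, Finset.card_univ, Fintype.card_fin,
          Set.ncard_eq_toFinset_card']
        congr 3
        ext z
        simp
      have h3 : (2 : ℝ) ≤ κ ^ L.ncard * (33 * (n : ℝ) ^ 2) ^ L.ncard := by
        rw [← mul_pow, hκv, div_mul_cancel₀ _ (by positivity)]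
        calc (2 : ℝ) = 2 ^ 1 := (pow_one 2).symm
          _ ≤ _ := pow_le_pow_right₀ one_le_two ((Set.ncard_pos (Set.toFinite L)).2 h0)
      calc (1 : ℝ) = 1 / 2 * 2 := by norm_num
        _ ≤ (1 - θ) ^ n * (κ ^ L.ncard * (33 * (n : ℝ) ^ 2) ^ L.ncard) :=
            mul_le_mul hθn h3 two_pos.le (by linarith)
        _ = (1 - θ) ^ n * κ ^ L.ncard * (33 * (n : ℝ) ^ 2) ^ L.ncard := (mul_assoc _ _ _).symm
        _ ≤ _ := mul_le_mul_of_nonneg_right (h2 ▸ h1) (by positivity)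
  have himg : (fun t => d * t + Pi.single y a) '' T' ⊆ T ∩ {t | 8 / 11 * c < t y} := by
    rintro _ ⟨t, ht, rfl⟩
    have ht0 : 0 ≤ t := fatten_region_nonneg G ht
    set s := d * t + Pi.single y a with hs
    have hlow : l ≤ l + A.indicator s := by
      intro z
      by_cases hz : z ∈ A
      · have : 0 ≤ s z := by
          rcases eq_or_ne z y with rfl | hzy
          · simpa [hs] using add_nonneg (mul_nonneg (hd0 z).le (ht0 z)) ha0.le
          · simpa [hs, hzy] using mul_nonneg (hd0 z).le (ht0 z)
        simpa [hz] using this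
      · simp [hz]
    -- a convex combination of a point of the new region and of the centroid
    have hcomb : l + A.indicator s ≤ (1 - θ) • (l' + A'.indicator t) + θ • x := by
      intro z
      have hlz : l z + (Pi.single y a : Fin n → ℝ) z = l' z := by
        rcases eq_or_ne z y with rfl | hzy
        · simp [hl'y]
        · simp [hzy, hl'z z hzy]
      by_cases hz : z ∈ A
      · by_cases hz' : z ∈ A'
        · simp only [Pi.add_apply, Set.indicator_of_mem hz, Set.indicator_of_mem hz', hs,
            Pi.mul_apply, hd, if_pos hz', Pi.smul_apply, smul_eq_mul]
          have := mul_le_mul_of_nonneg_left (hl'x0 z) hθ0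
          linarith
        · simp only [Pi.add_apply, Set.indicator_of_mem hz, Set.indicator_of_notMem hz', hs,
            Pi.mul_apply, hd, if_neg hz', if_pos hz, Pi.smul_apply, smul_eq_mul]
          have h1 : η / lam * t z ≤ η := by
            rw [div_mul_eq_mul_div, div_le_iff₀ hlam]
            exact mul_le_mul_of_nonneg_left (ht.1 z hz').2 hη0.le
          have h2 : κ * t z ≤ θ * η := by
            rw [hκ, mul_assoc]
            exact mul_le_mul_of_nonneg_left h1 hθ0
          have h3 := mul_le_mul_of_nonneg_left (hl'x z hz) hθ0
          linarith
      · have hz' : z ∉ A' := fun h => hz (hA' h)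
        have hzy : z ≠ y := fun h => hz (h ▸ hy)
        simp only [Pi.add_apply, Set.indicator_of_notMem hz, Set.indicator_of_notMem hz',
          Pi.smul_apply, smul_eq_mul, hl'z z hzy]
        have := mul_le_mul_of_nonneg_left (hxS.2.1 z) hθ0
        linarith
    have hmemX : (1 - θ) • (l' + A'.indicator t) + θ • x ∈ G.X :=
      G.convex ht.2.1 hxS.1 (by linarith) hθ0 (by ring)
    have hupp : l + A.indicator s ≤ h := by
      refine hcomb.trans fun z => ?_
      have h1 : l' z + A'.indicator t z ≤ h z := by
        by_cases hz' : z ∈ A'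
        · exact (ht.2.2.2 z).trans (hh' z hz')
        · simpa [hz'] using (hl'x0 z).trans (hxS.2.2 z)
      have h2 := hxS.2.2 z
      simp only [Pi.add_apply, Pi.smul_apply, smul_eq_mul]
      have h3 := mul_le_mul_of_nonneg_left h1 (by linarith : 0 ≤ 1 - θ)
      have h4 := mul_le_mul_of_nonneg_left h2 hθ0
      linarith
    refine ⟨⟨fun z hz => ?_, mem_of_le G hmemX (hl0.trans hlow) hcomb, hlow, hupp⟩, ?_⟩
    · have hz' : z ∉ A' := fun h => hz (hA' h)
      have hzy : z ≠ y := fun h => hz (h ▸ hy)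
      simpa [hs, hd, hz, hz', hzy] using ht.1 z hz'
    · have : a ≤ s y := by
        simpa [hs] using mul_nonneg (hd0 y).le (ht0 y)
      exact lt_of_lt_of_le ha_gt this
  have hvol' : (∏ z, d z) * volume.real T' ≤ 11 / 16 * volume.real T := by
    refine le_trans (le_of_eq ?_) ((measureReal_mono himg
      ((measure_mono Set.inter_subset_left).trans_lt hTc.measure_lt_top).ne).trans hcut)
    rw [volume_real_image_mul_add d _ (fun z => (hd0 z).ne') hT'c.measurableSet,
      abs_of_nonneg (Finset.prod_nonneg fun z _ => (hd0 z).le)]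
  have hcard : A.ncard = L.ncard + A'.ncard :=
    (Set.ncard_sdiff_add_ncard_of_subset hA' (Set.toFinite A)).symm
  set M : ℝ := 33 * (n : ℝ) ^ 2 with hM
  have hM0 : 0 < M := by positivity
  have hv0 : 0 ≤ volume.real T' := measureReal_nonneg
  calc volume.real T' * M ^ A'.ncard
      = 1 * (volume.real T' * M ^ A'.ncard) := (one_mul _).symm
    _ ≤ (∏ z, d z) * M ^ L.ncard * (volume.real T' * M ^ A'.ncard) :=
        mul_le_mul_of_nonneg_right hdprod (by positivity)
    _ = (∏ z, d z) * volume.real T' * M ^ A.ncard := by rw [hcard, pow_add]; ring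
    _ ≤ 11 / 16 * volume.real T * M ^ A.ncard :=
        mul_le_mul_of_nonneg_right hvol' (by positivity)
    _ = _ := mul_assoc _ _ _

end Cut

end Clinch

/-! ### The conservative optimum and approximate best responses -/

namespace SecurityGame

section Optimum

variable {n : ℕ} {G : SecurityGame n} {C ε : ℝ} {xs : Fin n → ℝ}

lemma mem_Icc_of_mem {x : Fin n → ℝ} (hx : x ∈ G.X) (z : Fin n) :
    x z ∈ Set.Icc (0 : ℝ) 1 :=
  ⟨(G.subset_cube hx).1 z, (G.subset_cube hx).2 z⟩

lemma HasSlopeBound.sub_le (hC : G.HasSlopeBound C) (y : Fin n) {s t : ℝ} (hs : 0 ≤ s)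
    (hst : s ≤ t) (ht : t ≤ 1) : G.v y s - G.v y t ≤ C * (t - s) := by
  rcases hst.eq_or_lt with rfl | hlt
  · simp
  · have := (hC.2 y s t hs hlt ht).1.2
    rwa [div_le_iff₀ (sub_pos.2 hlt)] at this

lemma HasSlopeBound.le_mul_sub (hC : G.HasSlopeBound C) (y : Fin n) {s t : ℝ} (hs : 0 ≤ s)
    (hst : s ≤ t) (ht : t ≤ 1) : t - s ≤ C * (G.v y s - G.v y t) := by
  have hC0 : 0 < C := one_pos.trans_le hC.1
  rcases hst.eq_or_lt with rfl | hlt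
  · simp
  · have := (hC.2 y s t hs hlt ht).1.1
    rw [div_le_div_iff₀ hC0 (sub_pos.2 hlt)] at this
    linarith

/-- No strategy pushes the agent's best payoff below its value at the conservative optimum.
Otherwise, lowering every coordinate of such a strategy as long as the agent's best payoff is not
increased keeps all the best responses to `xs`, each with a larger coverage than in `xs`, and hence
a larger payoff for the principal. -/
lemma IsConservativeOptimum.exists_le [NeZero n] (hxs : G.IsConservativeOptimum xs)
    {x : Fin n → ℝ} (hx : x ∈ G.X) : ∃ y, ∀ z, G.v z (xs z) ≤ G.v y (x y) := by
  classical
  by_contra! hcon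
  obtain ⟨y₁, hy₁⟩ := Finite.exists_max fun y => G.v y (x y)
  obtain ⟨z₁, hz₁⟩ := Finite.exists_max fun z => G.v z (xs z)
  set V := G.v y₁ (x y₁) with hV
  have hVlt : V < G.v z₁ (xs z₁) := by
    obtain ⟨z, hz⟩ := hcon y₁
    exact hz.trans_le (hz₁ z)
  have hw : ∀ y, ∃ w : ℝ, 0 ≤ w ∧ w ≤ x y ∧ G.v y w ≤ V ∧ (V < G.v y 0 → G.v y w = V) := by
    intro y
    obtain ⟨h0, h1⟩ := mem_Icc_of_mem hx y
    rcases le_or_gt (G.v y 0) V with hle | hlt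
    · exact ⟨0, le_rfl, h0, hle, fun h => absurd h (not_lt.2 hle)⟩
    · obtain ⟨w, ⟨hw0, hw1⟩, hwV⟩ := intermediate_value_Icc' h0
        ((G.v_continuous y).mono (Set.Icc_subset_Icc_right h1)) ⟨hy₁ y, hlt.le⟩
      exact ⟨w, hw0, hw1, hwV.le, fun _ => hwV⟩
  choose w hw0 hwx hwV hweq using hw
  have hwX : w ∈ G.X :=
    G.downwardClosed x hx w ⟨hw0, fun z => (hwx z).trans (mem_Icc_of_mem hx z).2⟩ hwx
  have hbr : ∀ y ∈ G.bestResp xs, y ∈ G.bestResp w ∧ G.u y (xs y) < G.u y (w y) := by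
    intro y hy
    have hxy := mem_Icc_of_mem hxs.1 y
    have hwy := mem_Icc_of_mem hwX y
    have h1 : V < G.v y (xs y) := hVlt.trans_le (hy z₁)
    have h2 : G.v y (xs y) ≤ G.v y 0 :=
      (G.v_strictAnti y).antitoneOn ⟨le_rfl, zero_le_one⟩ hxy hxy.1
    have h3 : G.v y (w y) = V := hweq y (h1.trans_le h2)
    refine ⟨fun z => (hwV z).trans h3.ge, G.u_strictMono y hxy hwy ?_⟩
    by_contra hle
    have := (G.v_strictAnti y).antitoneOn hwy hxy (not_lt.1 hle)
    linarith
  have hne : Nonempty (G.bestResp xs) := ⟨⟨z₁, hz₁⟩⟩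
  obtain ⟨y, hy⟩ := exists_eq_ciSup_of_finite (f := fun y : G.bestResp xs => G.u y (xs y))
  obtain ⟨hyw, hlt⟩ := hbr y.1 y.2
  have hle : G.u y (w y) ≤ G.principalValue w :=
    le_ciSup (f := fun y : G.bestResp w => G.u y (w y)) (Set.finite_range _).bddAbove ⟨y.1, hyw⟩
  have hopt := hxs.2.2 w hwX
  have : G.principalValue xs = G.u y (xs y) := hy.symm
  linarith

/-- An attacked target is covered by at most `C * ε` more than in the conservative optimum. -/
lemma IsConservativeOptimum.sub_le_of_mem_approxBestResp [NeZero n]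
    (hxs : G.IsConservativeOptimum xs) (hC : G.HasSlopeBound C) (hε : 0 ≤ ε)
    {x : Fin n → ℝ} (hx : x ∈ G.X) {y : Fin n} (hy : y ∈ G.approxBestResp ε x) :
    x y - C * ε ≤ xs y := by
  have hC0 : 0 < C := one_pos.trans_le hC.1
  rcases le_or_gt (x y) (xs y) with hle | hlt
  · have : 0 ≤ C * ε := by positivity
    linarith
  · obtain ⟨y₀, hy₀⟩ := hxs.exists_le hx
    have h1 := hC.le_mul_sub y (mem_Icc_of_mem hxs.1 y).1 hlt.le (mem_Icc_of_mem hx y).2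
    have h2 : G.v y (xs y) - G.v y (x y) ≤ ε := by
      have := hy y₀
      have := hy₀ y
      linarith
    have := mul_le_mul_of_nonneg_left h2 hC0.le
    linarith

/-- If the attacked target has nearly the coverage of the conservative optimum, then the agent's
payoffs exceed those at the conservative optimum by little. -/
lemma v_le_of_mem_approxBestResp (hxs : G.IsConservativeOptimum xs) (hC : G.HasSlopeBound C)
    {x : Fin n → ℝ} (hx : x ∈ G.X) {y : Fin n} (hy : y ∈ G.approxBestResp ε x) {lam : ℝ}
    (h1 : x y ≤ xs y) (h2 : xs y ≤ x y + lam) {z : Fin n} (hz : 0 < xs z) (w : Fin n) :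
    G.v w (x w) ≤ G.v z (xs z) + C * lam + ε := by
  have hC0 : 0 < C := one_pos.trans_le hC.1
  have h3 := hC.sub_le y (mem_Icc_of_mem hx y).1 h1 (mem_Icc_of_mem hxs.1 y).2
  have h4 : G.v y (xs y) ≤ G.v z (xs z) := hxs.2.1 z hz y
  have h5 := hy w
  have h6 : C * (xs y - x y) ≤ C * lam := mul_le_mul_of_nonneg_left (by linarith) hC0.le
  linarith

/-- If the agent's payoff for a target exceeds the one at the conservative optimum by at most `e`,
then the target is covered almost as much as in the conservative optimum. -/
lemma HasSlopeBound.le_add_of_v_le (hC : G.HasSlopeBound C) {y : Fin n} {s t e : ℝ} (hs : 0 ≤ s)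
    (ht : t ≤ 1) (he : 0 ≤ e) (h : G.v y s ≤ G.v y t + e) : t ≤ s + C * e := by
  have hC0 : 0 < C := one_pos.trans_le hC.1
  rcases le_or_gt t s with hle | hlt
  · have : 0 ≤ C * e := by positivity
    linarith
  · have h1 := hC.le_mul_sub y hs hlt.le ht
    have := mul_le_mul_of_nonneg_left (by linarith : G.v y s - G.v y t ≤ e) hC0.le
    linarith

end Optimum

end SecurityGame

/-! ### While loops -/

namespace Clinch

section WhileLoop

variable {σ : Type} {cond : σ → Prop} {body : σ → σ}

lemma iterate_mem_whileLoop {k : ℕ} : ∀ {s : σ}, (∀ j < k, cond (body^[j] s)) →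
    ¬ cond (body^[k] s) → body^[k] s ∈ whileLoop cond body s := by
  induction k with
  | zero =>
    intro s _ hdone
    apply PFun.fix_stop
    have hs : ¬ cond s := hdone
    simp [whileStep, hs]
  | succ k ih =>
    intro s hrun hdone
    have hs : cond s := hrun 0 (Nat.succ_pos k)
    have hstep : Sum.inr (body s) ∈ (PFun.lift (whileStep cond body) : σ →. σ ⊕ σ) s := by
      simp [whileStep, hs]
    rw [whileLoop, PFun.fix_fwd_eq hstep]
    exact ih (fun j hj => hrun (j + 1) (Nat.succ_lt_succ hj)) hdone

/-- A while loop whose condition cannot hold for more than `B` consecutive rounds terminates. -/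
lemma exists_iterate_mem_whileLoop {s : σ} {B : ℝ}
    (hB : ∀ k : ℕ, (∀ j < k, cond (body^[j] s)) → (k : ℝ) ≤ B) :
    ∃ k : ℕ, (k : ℝ) ≤ B ∧ ¬ cond (body^[k] s) ∧ (∀ j < k, cond (body^[j] s)) ∧
      body^[k] s ∈ whileLoop cond body s := by
  classical
  have hex : ∃ k, ¬ cond (body^[k] s) := by
    by_contra! hall
    have h1 := hB (⌊B⌋₊ + 1) fun j _ => hall j
    have h2 := Nat.lt_floor_add_one B
    push_cast at h1
    linarith
  have hlt : ∀ j < Nat.find hex, cond (body^[j] s) := fun j hj => by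
    simpa using Nat.find_min hex hj
  exact ⟨Nat.find hex, hB _ hlt, Nat.find_spec hex, hlt,
    iterate_mem_whileLoop hlt (Nat.find_spec hex)⟩

end WhileLoop

/-! ### The main loop -/

section MainLoop

variable {n : ℕ}

/-- The loop invariant. A coordinate is free if it belongs to `s.R`, and locked otherwise. The
bounds stay valid for the optimum `xs`, except that it may exceed the upper bound by up to `lam`
in a locked coordinate. -/
structure Invariant (G : SecurityGame n) (lam : ℝ) (xs lo₀ hi₀ : Fin n → ℝ) (s : LoopState n) :
    Prop where
  lo_mem : s.lo ∈ G.X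
  lo_le_xs : s.lo ≤ xs
  lo_le_hi : s.lo ≤ s.hi
  le_lo : lo₀ ≤ s.lo
  hi_le : s.hi ≤ hi₀
  xs_le_hi : ∀ z ∈ s.R, xs z ≤ s.hi z
  hi_eq_lo : ∀ z ∉ s.R, s.hi z = s.lo z
  xs_le_lo_add : ∀ z ∉ s.R, xs z ≤ s.lo z + lam
  mem_S : ∀ w ∈ G.X, s.lo ≤ w → w ≤ s.hi → w ∈ s.S

variable {G : SecurityGame n} {C ε lam : ℝ} {xs lo₀ hi₀ : Fin n → ℝ}
  {answer : ℕ → (Fin n → ℝ) → Fin n} {s : LoopState n}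

lemma loopBody_S : (loopBody G.X C ε lam answer s).S =
    region G.X s.lo (loopBody G.X C ε lam answer s).hi := rfl

lemma loopBody_x : (loopBody G.X C ε lam answer s).x =
    centroid (region G.X s.lo (loopBody G.X C ε lam answer s).hi) := rfl

lemma loopBody_lo : (loopBody G.X C ε lam answer s).lo =
    Function.update s.lo (loopBody G.X C ε lam answer s).y
      (max (s.lo (loopBody G.X C ε lam answer s).y)
        ((loopBody G.X C ε lam answer s).x (loopBody G.X C ε lam answer s).y - C * ε)) := rfl

lemma mem_loopBody_R {z : Fin n} : z ∈ (loopBody G.X C ε lam answer s).R ↔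
    z ∈ s.R ∧ s.lo + Pi.single z lam ∈ s.S := by
  simp [loopBody]

lemma loopBody_hi_of_mem {z : Fin n} (hz : s.lo + Pi.single z lam ∈ s.S) :
    (loopBody G.X C ε lam answer s).hi z = s.hi z := by
  simp [loopBody, hz]

lemma loopBody_hi_of_notMem {z : Fin n} (hz : s.lo + Pi.single z lam ∉ s.S) :
    (loopBody G.X C ε lam answer s).hi z = s.lo z := by
  simp [loopBody, hz]

namespace Invariant

lemma loopBody_hi_eq_lo (h : Invariant G lam xs lo₀ hi₀ s) {z : Fin n}
    (hz : z ∉ (loopBody G.X C ε lam answer s).R) :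
    (loopBody G.X C ε lam answer s).hi z = s.lo z := by
  by_cases hS : s.lo + Pi.single z lam ∈ s.S
  · rw [loopBody_hi_of_mem hS]
    exact h.hi_eq_lo z fun hR => hz (mem_loopBody_R.2 ⟨hR, hS⟩)
  · exact loopBody_hi_of_notMem hS

lemma loopBody_hi_le (h : Invariant G lam xs lo₀ hi₀ s) :
    (loopBody G.X C ε lam answer s).hi ≤ s.hi := by
  intro z
  by_cases hS : s.lo + Pi.single z lam ∈ s.S
  · rw [loopBody_hi_of_mem hS]
  · rw [loopBody_hi_of_notMem hS]
    exact h.lo_le_hi z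

lemma lo_le_loopBody_hi (h : Invariant G lam xs lo₀ hi₀ s) :
    s.lo ≤ (loopBody G.X C ε lam answer s).hi := by
  intro z
  by_cases hS : s.lo + Pi.single z lam ∈ s.S
  · rw [loopBody_hi_of_mem hS]
    exact h.lo_le_hi z
  · rw [loopBody_hi_of_notMem hS]

lemma loopBody_x_mem [NeZero n] (h : Invariant G lam xs lo₀ hi₀ s) :
    (loopBody G.X C ε lam answer s).x ∈ region G.X s.lo (loopBody G.X C ε lam answer s).hi :=
  centroid_mem_region G h.lo_mem h.lo_le_loopBody_hi

lemma lo_le_loopBody_lo : s.lo ≤ (loopBody G.X C ε lam answer s).lo := by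
  intro z
  rw [loopBody_lo]
  rcases eq_or_ne z (loopBody G.X C ε lam answer s).y with rfl | hz
  · rw [Function.update_self]
    exact le_max_left _ _
  · rw [Function.update_of_ne hz]

lemma loopBody_lo_le_x [NeZero n] (h : Invariant G lam xs lo₀ hi₀ s) (hCε : 0 ≤ C * ε) :
    (loopBody G.X C ε lam answer s).lo ≤ (loopBody G.X C ε lam answer s).x := by
  intro z
  rw [loopBody_lo]
  rcases eq_or_ne z (loopBody G.X C ε lam answer s).y with rfl | hz
  · rw [Function.update_self]
    exact max_le (h.loopBody_x_mem.2.1 _) (by linarith)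
  · rw [Function.update_of_ne hz]
    exact h.loopBody_x_mem.2.1 z

lemma loopBody_lo_eq [NeZero n] (h : Invariant G lam xs lo₀ hi₀ s) (hCε : 0 ≤ C * ε) {z : Fin n}
    (hz : z ∉ (loopBody G.X C ε lam answer s).R) :
    (loopBody G.X C ε lam answer s).lo z = s.lo z :=
  le_antisymm (((h.loopBody_lo_le_x hCε z).trans (h.loopBody_x_mem.2.2 z)).trans
    (h.loopBody_hi_eq_lo hz).le) (lo_le_loopBody_lo z)

protected lemma loopBody [NeZero n] (h : Invariant G lam xs lo₀ hi₀ s) (hlam : 0 ≤ lam)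
    (hxs : G.IsConservativeOptimum xs) (hC : G.HasSlopeBound C) (hε : 0 ≤ ε)
    (ho : G.IsApproxOracle ε answer) :
    Invariant G lam xs lo₀ hi₀ (loopBody G.X C ε lam answer s) := by
  have hCε : 0 ≤ C * ε := mul_nonneg (one_pos.trans_le hC.1).le hε
  have hx := h.loopBody_x_mem (C := C) (ε := ε) (answer := answer)
  have hlox := h.loopBody_lo_le_x hCε (answer := answer)
  have hlo0 : 0 ≤ (loopBody G.X C ε lam answer s).lo :=
    (G.subset_cube h.lo_mem).1.trans lo_le_loopBody_lo
  refine
    { lo_mem := mem_of_le G hx.1 hlo0 hlox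
      lo_le_xs := ?_
      lo_le_hi := hlox.trans hx.2.2
      le_lo := h.le_lo.trans lo_le_loopBody_lo
      hi_le := h.loopBody_hi_le.trans h.hi_le
      xs_le_hi := ?_
      hi_eq_lo := ?_
      xs_le_lo_add := ?_
      mem_S := ?_ }
  · intro z
    rw [loopBody_lo]
    rcases eq_or_ne z (loopBody G.X C ε lam answer s).y with rfl | hz
    · rw [Function.update_self]
      exact max_le (h.lo_le_xs _)
        (hxs.sub_le_of_mem_approxBestResp hC hε hx.1 (ho s.queries _ hx.1))
    · rw [Function.update_of_ne hz]
      exact h.lo_le_xs z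
  · intro z hz
    obtain ⟨hR, hS⟩ := mem_loopBody_R.1 hz
    rw [loopBody_hi_of_mem hS]
    exact h.xs_le_hi z hR
  · intro z hz
    rw [h.loopBody_hi_eq_lo hz, h.loopBody_lo_eq hCε hz]
  · intro z hz
    rw [h.loopBody_lo_eq hCε hz]
    by_cases hR : z ∈ s.R
    · by_contra! hlt
      -- otherwise the raised lower bound would lie between `s.lo` and `xs`, hence in `s.S`
      refine hz (mem_loopBody_R.2 ⟨hR, h.mem_S _ (mem_of_le G hxs.1 ?_ ?_) ?_ ?_⟩)
      · intro w
        rcases eq_or_ne w z with rfl | hw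
        · simpa using add_nonneg ((G.subset_cube h.lo_mem).1 w) hlam
        · simpa [hw] using (G.subset_cube h.lo_mem).1 w
      · intro w
        rcases eq_or_ne w z with rfl | hw
        · simpa using hlt.le
        · simpa [hw] using h.lo_le_xs w
      · intro w
        rcases eq_or_ne w z with rfl | hw
        · simpa using hlam
        · simp [hw]
      · intro w
        rcases eq_or_ne w z with rfl | hw
        · simpa using hlt.le.trans (h.xs_le_hi w hR)
        · simpa [hw] using h.lo_le_hi w
    · exact h.xs_le_lo_add z hR
  · intro w hwX hlw hwh
    exact ⟨hwX, lo_le_loopBody_lo.trans hlw, hwh⟩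

end Invariant

lemma invariant_initState [NeZero n] {lo hi : Fin n → ℝ} (hxs : xs ∈ G.X) (hlo : lo ≤ xs)
    (hhi : xs ≤ hi) : Invariant G lam xs lo hi (initState G.X lo hi) := by
  have hle : (initState G.X lo hi).lo ≤ xs := fun z => max_le (hlo z) ((G.subset_cube hxs).1 z)
  exact
    { lo_mem := mem_of_le G hxs (fun z => le_max_right _ _) hle
      lo_le_xs := hle
      lo_le_hi := hle.trans hhi
      le_lo := fun z => le_max_left _ _
      hi_le := le_rfl
      xs_le_hi := fun z _ => hhi z
      hi_eq_lo := fun z hz => absurd (Set.mem_univ z) hz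
      xs_le_lo_add := fun z hz => absurd (Set.mem_univ z) hz
      mem_S := fun w hw _ _ => hw }

/-- The potential of the round that starts in the state `s`: the volume of the thickened search
region of this round, times a factor `33 * n ^ 2` for each coordinate that is still free. -/
noncomputable def potential (G : SecurityGame n) (C ε lam : ℝ)
    (answer : ℕ → (Fin n → ℝ) → Fin n) (s : LoopState n) : ℝ :=
  volume.real (fatten (region G.X s.lo (loopBody G.X C ε lam answer s).hi) s.lo
    (loopBody G.X C ε lam answer s).R lam) *
    (33 * (n : ℝ) ^ 2) ^ (loopBody G.X C ε lam answer s).R.ncard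

/-- After the first round, free directions have width at least `lam` in the new search region. -/
lemma add_single_mem_region {l : Fin n → ℝ} (hS : s.S = region G.X l s.hi) (hlam : 0 ≤ lam)
    {z : Fin n} (hz : z ∈ (loopBody G.X C ε lam answer s).R) :
    s.lo + Pi.single z lam ∈ region G.X s.lo (loopBody G.X C ε lam answer s).hi := by
  have hmem := (mem_loopBody_R.1 hz).2
  have hmem' := hmem
  rw [hS] at hmem'
  refine ⟨hmem'.1, fun w => ?_, fun w => ?_⟩
  · rcases eq_or_ne w z with rfl | hw
    · simpa using hlam
    · simp [hw]
  · by_cases hw : s.lo + Pi.single w lam ∈ s.S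
    · rw [loopBody_hi_of_mem hw]
      exact hmem'.2.2 w
    · have : w ≠ z := fun h => hw (h ▸ hmem)
      simp [loopBody_hi_of_notMem hw, this]

/-- The hypothesis `hS` holds in every round but the first, in which `s.S = G.X` and free directions
may be arbitrarily thin. -/
lemma Invariant.potential_loopBody_le [NeZero n] (h : Invariant G lam xs lo₀ hi₀ s)
    {l : Fin n → ℝ} (hS : s.S = region G.X l s.hi) (hlam : 0 < lam)
    (hCε : C * ε = 4 * lam / (33 * n))
    (hy : (loopBody G.X C ε lam answer s).y ∈ (loopBody G.X C ε lam answer s).R) :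
    potential G C ε lam answer (loopBody G.X C ε lam answer s) ≤
      11 / 16 * potential G C ε lam answer s := by
  have hn : (1 : ℝ) ≤ n := Nat.one_le_cast.2 (Nat.pos_of_ne_zero (NeZero.ne n))
  have hflat : ∀ z ∉ (loopBody G.X C ε lam answer s).R,
      (loopBody G.X C ε lam answer s).hi z = s.lo z := fun z hz => h.loopBody_hi_eq_lo hz
  have hr : ∀ z ∈ (loopBody G.X C ε lam answer s).R, s.lo + Pi.single z lam ∈
      region G.X s.lo (loopBody G.X C ε lam answer s).hi :=
    fun z hz => add_single_mem_region hS hlam.le hz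
  refine volume_fatten_cut G h.lo_mem h.lo_le_loopBody_hi hlam hflat hr hy hCε ?_ ?_ ?_
  · have h1 := div_le_centroid_sub G h.lo_mem h.lo_le_loopBody_hi hlam hflat hr hy
    have h2 : C * ε ≤ lam / (n + 1) := by
      rw [hCε, div_le_div_iff₀ (by positivity) (by positivity)]
      nlinarith
    rw [loopBody_lo, loopBody_x, max_eq_right (by linarith)]
  · exact fun z hz => (mem_loopBody_R.1 hz).1
  · exact fun z hz => (loopBody_hi_of_mem (mem_loopBody_R.1 hz).2).le

lemma Invariant.le_potential [NeZero n] (h : Invariant G lam xs lo₀ hi₀ s)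
    {l : Fin n → ℝ} (hS : s.S = region G.X l s.hi) (hlam : 0 < lam) :
    (lam / n) ^ n ≤ potential G C ε lam answer s := by
  have hn : (1 : ℝ) ≤ n := Nat.one_le_cast.2 (Nat.pos_of_ne_zero (NeZero.ne n))
  have h1 := prod_le_volume_fatten_region G h.lo_mem
    (h.lo_le_loopBody_hi (C := C) (ε := ε) (answer := answer)) hlam.le
    (A := (loopBody G.X C ε lam answer s).R) (r := fun _ => lam)
    (fun z hz => add_single_mem_region hS hlam.le hz) (fun _ => lam / n)
    (fun _ => by positivity) (fun _ _ => le_rfl) (fun _ _ => div_le_self hlam.le hn)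
  simp only [Finset.prod_const, Finset.card_univ, Fintype.card_fin] at h1
  refine h1.trans (le_mul_of_one_le_right measureReal_nonneg (one_le_pow₀ ?_))
  nlinarith

lemma Invariant.potential_le [NeZero n] (h : Invariant G lam xs lo₀ hi₀ s) {α : ℝ}
    (hα : ∀ z, hi₀ z - lo₀ z ≤ α) (hlam : lam ≤ α) (hα0 : 0 ≤ α) :
    potential G C ε lam answer s ≤ (α * (33 * (n : ℝ) ^ 2)) ^ n := by
  have hn : (1 : ℝ) ≤ n := Nat.one_le_cast.2 (Nat.pos_of_ne_zero (NeZero.ne n))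
  have hsub : fatten (region G.X s.lo (loopBody G.X C ε lam answer s).hi) s.lo
      (loopBody G.X C ε lam answer s).R lam ⊆ Set.Icc 0 (fun _ => α) := by
    intro t ht
    refine ⟨fatten_region_nonneg G ht, fun z => ?_⟩
    by_cases hz : z ∈ (loopBody G.X C ε lam answer s).R
    · have h1 := ht.2.2.2 z
      rw [Pi.add_apply, Set.indicator_of_mem hz] at h1
      have h2 := ((h.loopBody_hi_le (C := C) (ε := ε) (answer := answer)).trans h.hi_le) z
      have h3 := h.le_lo z
      have h4 := hα z
      simp only
      linarith
    · exact (ht.1 z hz).2.trans hlam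
  have hvol : volume.real (fatten (region G.X s.lo (loopBody G.X C ε lam answer s).hi) s.lo
      (loopBody G.X C ε lam answer s).R lam) ≤ α ^ n := by
    refine (measureReal_mono hsub isCompact_Icc.measure_lt_top.ne).trans (le_of_eq ?_)
    have hle : (0 : Fin n → ℝ) ≤ fun _ => α := fun _ => hα0
    rw [Measure.real, Real.volume_Icc_pi_toReal hle]
    simp
  have hcard : (loopBody G.X C ε lam answer s).R.ncard ≤ n := by
    simpa using Set.ncard_le_card (loopBody G.X C ε lam answer s).R
  rw [mul_pow]
  refine mul_le_mul hvol (pow_le_pow_right₀ ?_ hcard) (by positivity) (by positivity)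
  nlinarith

/-- If the body of the main loop is entered at least three times, and attacks free targets in the
rounds before the last, then the potential argument bounds the number of rounds. -/
lemma pow_le_of_forall_mem_R [NeZero n] {s₀ : LoopState n} (h : Invariant G lam xs lo₀ hi₀ s₀)
    (hlam : 0 < lam) (hxs : G.IsConservativeOptimum xs) (hC : G.HasSlopeBound C) (hε : 0 ≤ ε)
    (ho : G.IsApproxOracle ε answer) (hCε : C * ε = 4 * lam / (33 * n)) {α : ℝ}
    (hα : ∀ z, hi₀ z - lo₀ z ≤ α) {m : ℕ} (hm : 0 < m)
    (hrun : ∀ j < m + 2, ((loopBody G.X C ε lam answer)^[j] s₀).y ∈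
      ((loopBody G.X C ε lam answer)^[j] s₀).R) :
    lam ≤ α ∧ (16 / 11 : ℝ) ^ m ≤ (33 * (n : ℝ) ^ 3 * (α / lam)) ^ n := by
  have hn : (1 : ℝ) ≤ n := Nat.one_le_cast.2 (Nat.pos_of_ne_zero (NeZero.ne n))
  set f := loopBody G.X C ε lam answer with hf
  have hinv : ∀ j, Invariant G lam xs lo₀ hi₀ (f^[j] s₀) := by
    intro j
    induction j with
    | zero => exact h
    | succ j ih =>
      rw [Function.iterate_succ_apply']
      exact ih.loopBody hlam.le hxs hC hε ho
  have hreg : ∀ j, ∃ l, (f^[j + 1] s₀).S = region G.X l (f^[j + 1] s₀).hi := by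
    intro j
    rw [Function.iterate_succ_apply']
    exact ⟨_, loopBody_S⟩
  have hpot : ∀ j ≤ m, potential G C ε lam answer (f^[j + 1] s₀) ≤
      (11 / 16) ^ j * potential G C ε lam answer (f^[1] s₀) := by
    intro j
    induction j with
    | zero => simp
    | succ j ih =>
      intro hj
      obtain ⟨l, hl⟩ := hreg j
      have hy := hrun (j + 2) (by omega)
      rw [Function.iterate_succ_apply'] at hy
      have h1 := (hinv (j + 1)).potential_loopBody_le hl hlam hCε hy
      rw [Function.iterate_succ_apply' f (j + 1), pow_succ]
      have h2 := ih (by omega)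
      linarith
  have hlamα : lam ≤ α := by
    obtain ⟨l, hl⟩ := hreg 0
    have hy := hrun 2 (by omega)
    rw [Function.iterate_succ_apply'] at hy
    have h1 := (add_single_mem_region hl hlam.le hy).2.2 (f (f^[1] s₀)).y
    rw [Pi.add_apply, Pi.single_eq_same] at h1
    have h2 := (((hinv 1).loopBody_hi_le (C := C) (ε := ε) (answer := answer)).trans
      (hinv 1).hi_le) (f (f^[1] s₀)).y
    have h3 := (hinv 1).le_lo (f (f^[1] s₀)).y
    have h4 := hα (f (f^[1] s₀)).y
    linarith
  refine ⟨hlamα, ?_⟩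
  obtain ⟨l, hl⟩ := hreg m
  have h1 := (hinv (m + 1)).le_potential (C := C) (ε := ε) (answer := answer) hl hlam
  have h2 := (hinv 1).potential_le (C := C) (ε := ε) (answer := answer) hα hlamα
    (hlam.le.trans hlamα)
  have h3 := h1.trans ((hpot m le_rfl).trans
    (mul_le_mul_of_nonneg_left h2 (by positivity : (0 : ℝ) ≤ (11 / 16) ^ m)))
  have h4 : (33 * (n : ℝ) ^ 3 * (α / lam)) ^ n * (lam / n) ^ n =
      (α * (33 * (n : ℝ) ^ 2)) ^ n := by
    rw [← mul_pow]
    congr 1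
    field_simp
  have h5 : (16 / 11 : ℝ) ^ m * (11 / 16) ^ m = 1 := by
    rw [← mul_pow]
    norm_num
  refine le_of_mul_le_mul_right ?_ (by positivity : (0 : ℝ) < (lam / n) ^ n)
  calc (16 / 11 : ℝ) ^ m * (lam / n) ^ n
      ≤ (16 / 11) ^ m * ((11 / 16) ^ m * (α * (33 * (n : ℝ) ^ 2)) ^ n) :=
        mul_le_mul_of_nonneg_left h3 (by positivity)
    _ = _ := by rw [← mul_assoc, h5, one_mul, h4]

end MainLoop

/-! ### The binary searches -/

section Search

variable {n : ℕ} {G : SecurityGame n} {C ε lam : ℝ} {xs x : Fin n → ℝ}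
  {answer : ℕ → (Fin n → ℝ) → Fin n}

/-- The invariant of the binary search for the target `z` between `l₀` and `x z`, after `k`
rounds. -/
structure SearchInvariant (C ε lam l₀ xz xsz : ℝ) (q k : ℕ) (s : SearchState) : Prop where
  le_l : l₀ ≤ s.l
  u_le : s.u ≤ xz
  l_le_xs : s.l ≤ xsz + C * ε
  xs_le_u : xsz ≤ s.u + C * (C * lam + 2 * ε)
  width : s.u - s.l = (xz - l₀) / 2 ^ k
  queries : s.queries = q + k

/-- An answer `z` shows that the midpoint is not much above the optimum, as in the main loop. For
any other answer `w`, the payoff of `w` bounds that of `z`, so the midpoint is not much below. -/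
lemma SearchInvariant.searchBody [NeZero n] (hxs : G.IsConservativeOptimum xs)
    (hC : G.HasSlopeBound C) (hε : 0 ≤ ε) (hlam : 0 ≤ lam) (ho : G.IsApproxOracle ε answer)
    (hx : x ∈ G.X) {z : Fin n} {l₀ : ℝ} (hl₀ : 0 ≤ l₀) (hlx : l₀ ≤ x z)
    (hV : 0 < xs z → ∀ w, G.v w (x w) ≤ G.v z (xs z) + C * lam + ε) {q k : ℕ} {s : SearchState}
    (h : SearchInvariant C ε lam l₀ (x z) (xs z) q k s) :
    SearchInvariant C ε lam l₀ (x z) (xs z) q (k + 1) (searchBody answer x z s) := by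
  have hC0 : 0 < C := one_pos.trans_le hC.1
  have hlu : s.l ≤ s.u := by
    have : 0 ≤ (x z - l₀) / 2 ^ k := div_nonneg (sub_nonneg.2 hlx) (by positivity)
    linarith [h.width]
  have hw := h.width
  have hll := h.le_l
  have hul := h.u_le
  set m := (s.u + s.l) / 2 with hm
  have hm0 : 0 ≤ m := by rw [hm]; linarith
  have hmx : m ≤ x z := by rw [hm]; linarith
  have hx'X : Function.update x z m ∈ G.X := by
    refine mem_of_le G hx (fun w => ?_) (fun w => ?_)
    · rcases eq_or_ne w z with rfl | hwz
      · simpa using hm0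
      · simpa [hwz] using (G.subset_cube hx).1 w
    · rcases eq_or_ne w z with rfl | hwz
      · simpa using hmx
      · simp [hwz]
  have hans := ho s.queries _ hx'X
  have hq : s.queries + 1 = q + (k + 1) := by rw [h.queries]; ring
  by_cases hz : answer s.queries (Function.update x z m) = z
  · have hbody : Clinch.searchBody answer x z s = ⟨m, s.u, s.queries + 1⟩ := by
      simp only [Clinch.searchBody]
      rw [← hm, if_pos hz]
    rw [hbody]
    rw [hz] at hans
    have h1 := hxs.sub_le_of_mem_approxBestResp hC hε hx'X hans
    rw [Function.update_self] at h1
    exact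
      { le_l := by simp only [hm]; linarith
        u_le := h.u_le
        l_le_xs := by simp only; linarith
        xs_le_u := h.xs_le_u
        width := by simp only [hm]; rw [pow_succ, ← div_div, ← hw]; ring
        queries := hq }
  · have hbody : Clinch.searchBody answer x z s = ⟨s.l, m, s.queries + 1⟩ := by
      simp only [Clinch.searchBody]
      rw [← hm, if_neg hz]
    rw [hbody]
    have h1 := hans z
    rw [Function.update_self, Function.update_of_ne hz] at h1
    have he : 0 ≤ C * lam + 2 * ε := by positivity
    exact
      { le_l := h.le_l
        u_le := hmx
        l_le_xs := h.l_le_xs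
        xs_le_u := by
          rcases le_or_gt (xs z) 0 with hz0 | hz0
          · have : 0 ≤ C * (C * lam + 2 * ε) := by positivity
            simp only
            linarith
          · refine hC.le_add_of_v_le (y := z) hm0 (SecurityGame.mem_Icc_of_mem hxs.1 z).2 he ?_
            have := hV hz0 (answer s.queries (Function.update x z m))
            linarith
        width := by simp only [hm]; rw [pow_succ, ← div_div, ← hw]; ring
        queries := hq }

lemma exists_mem_whileLoop_search [NeZero n] (hxs : G.IsConservativeOptimum xs)
    (hC : G.HasSlopeBound C) (hε : 0 ≤ ε) (hlam : 0 < lam) (ho : G.IsApproxOracle ε answer)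
    (hx : x ∈ G.X) {z : Fin n} {l₀ : ℝ} (hl₀ : 0 ≤ l₀) (hlx : l₀ ≤ x z) (hlxs : l₀ ≤ xs z)
    (hV : 0 < xs z → ∀ w, G.v w (x w) ≤ G.v z (xs z) + C * lam + ε) {B : ℝ} (hB0 : 0 ≤ B)
    (hB : ∀ k : ℕ, lam * 2 ^ k ≤ x z - l₀ → (k : ℝ) + 1 ≤ B) (q : ℕ) :
    ∃ s ∈ whileLoop (fun s : SearchState => lam ≤ s.u - s.l) (searchBody answer x z)
        { l := l₀, u := x z, queries := q },
      l₀ ≤ s.l ∧ s.l ≤ x z ∧ s.l ≤ xs z + C * ε ∧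
      xs z ≤ s.l + (lam + C * (C * lam + 2 * ε)) ∧ (s.queries : ℝ) ≤ q + B := by
  have hC0 : 0 < C := one_pos.trans_le hC.1
  set s₀ : SearchState := { l := l₀, u := x z, queries := q } with hs₀
  have hinit : SearchInvariant C ε lam l₀ (x z) (xs z) q 0 s₀ :=
    { le_l := le_rfl
      u_le := le_rfl
      l_le_xs := by
        have : 0 ≤ C * ε := by positivity
        simp only [hs₀]
        linarith
      xs_le_u := by
        rcases le_or_gt (xs z) 0 with hz0 | hz0
        · have : 0 ≤ C * (C * lam + 2 * ε) := by positivity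
          simp only [hs₀]
          linarith
        · refine hC.le_add_of_v_le (y := z) (hl₀.trans hlx) (SecurityGame.mem_Icc_of_mem hxs.1 z).2
            (by positivity) ?_
          have := hV hz0 z
          change G.v z (x z) ≤ _
          linarith
      width := by simp [hs₀]
      queries := rfl }
  have hinv : ∀ k, SearchInvariant C ε lam l₀ (x z) (xs z) q k
      ((searchBody answer x z)^[k] s₀) := by
    intro k
    induction k with
    | zero => exact hinit
    | succ k ih =>
      rw [Function.iterate_succ_apply']
      exact ih.searchBody hxs hC hε hlam.le ho hx hl₀ hlx hV
  obtain ⟨k, hkB, hdone, -, hmem⟩ := exists_iterate_mem_whileLoop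
    (cond := fun s : SearchState => lam ≤ s.u - s.l) (body := searchBody answer x z) (s := s₀)
    (B := B) (by
      intro k hk
      rcases k with _ | k
      · simpa using hB0
      · have h1 := hk k (Nat.lt_succ_self k)
        rw [(hinv k).width, le_div_iff₀ (by positivity)] at h1
        simpa using hB k h1)
  refine ⟨_, hmem, (hinv k).le_l, ?_, (hinv k).l_le_xs, ?_, ?_⟩
  · have h1 : 0 ≤ (x z - l₀) / 2 ^ k := div_nonneg (sub_nonneg.2 hlx) (by positivity)
    linarith [(hinv k).width, (hinv k).u_le]
  · have := (hinv k).xs_le_u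
    have := not_le.1 hdone
    linarith
  · rw [(hinv k).queries]
    push_cast
    linarith

/-- If every binary search makes at most `B` queries and returns a value with the property `P`, then
so does the loop over all the targets. -/
lemma exists_mem_conserveMass (lo : Fin n → ℝ) {P : Fin n → ℝ → Prop} {B : ℝ}
    (hsearch : ∀ (z : Fin n) (q : ℕ), ∃ s ∈ whileLoop (fun s : SearchState => lam ≤ s.u - s.l)
      (searchBody answer x z) { l := lo z, u := x z, queries := q },
      P z s.l ∧ (s.queries : ℝ) ≤ q + B) (q : ℕ) :
    ∃ r ∈ conserveMass answer x lam lo q, (∀ z, P z (r.1 z)) ∧ (r.2 : ℝ) ≤ q + n * B := by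
  set f : (Fin n → ℝ) × ℕ → Fin n → Part ((Fin n → ℝ) × ℕ) := fun acc y => do
      let s ← whileLoop (fun s : SearchState => lam ≤ s.u - s.l) (searchBody answer x y)
        { l := lo y, u := x y, queries := acc.2 }
      pure (Function.update acc.1 y s.l, s.queries) with hf
  have key : ∀ (L : List (Fin n)) (acc : (Fin n → ℝ) × ℕ), ∃ r ∈ L.foldlM f acc,
      (∀ z ∈ L, P z (r.1 z)) ∧ (∀ z ∉ L, r.1 z = acc.1 z) ∧ (r.2 : ℝ) ≤ acc.2 + L.length * B := by
    intro L
    induction L with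
    | nil =>
      intro acc
      exact ⟨acc, by simp, by simp, by simp, by simp⟩
    | cons y L ih =>
      intro acc
      obtain ⟨s, hs, hP, hq⟩ := hsearch y acc.2
      obtain ⟨r, hr, hr1, hr2, hr3⟩ := ih (Function.update acc.1 y s.l, s.queries)
      refine ⟨r, ?_, ?_, ?_, ?_⟩
      · rw [List.foldlM_cons]
        refine Part.mem_bind ?_ hr
        exact Part.mem_bind hs (Part.mem_some _)
      · intro z hz
        by_cases hzL : z ∈ L
        · exact hr1 z hzL
        · have hzy : z = y := (List.mem_cons.1 hz).resolve_right hzL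
          subst hzy
          rw [hr2 z hzL]
          simpa using hP
      · intro z hz
        rw [List.mem_cons, not_or] at hz
        rw [hr2 z hz.2]
        simp [hz.1]
      · simp only at hr3
        push_cast [List.length_cons]
        linarith
  obtain ⟨r, hr, h1, -, h3⟩ := key (List.finRange n) (x, q)
  exact ⟨r, hr, fun z => h1 z (List.mem_finRange z), by simpa using h3⟩

end Search

/-! ### The algorithm -/

section Main

variable {n : ℕ}

/-- What the main loop guarantees when it stops: the attacked target is locked, hence has nearly its
optimal coverage. -/
lemma Invariant.v_le_of_notMem_R [NeZero n] {G : SecurityGame n} {C ε lam : ℝ}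
    {xs lo₀ hi₀ : Fin n → ℝ} {answer : ℕ → (Fin n → ℝ) → Fin n} {s : LoopState n}
    (h : Invariant G lam xs lo₀ hi₀ s) (hlam : 0 ≤ lam) (hxs : G.IsConservativeOptimum xs)
    (hC : G.HasSlopeBound C) (hε : 0 ≤ ε) (ho : G.IsApproxOracle ε answer)
    (hdone : (loopBody G.X C ε lam answer s).y ∉ (loopBody G.X C ε lam answer s).R) {z : Fin n}
    (hz : 0 < xs z) (w : Fin n) :
    G.v w ((loopBody G.X C ε lam answer s).x w) ≤ G.v z (xs z) + C * lam + ε := by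
  have hCε : 0 ≤ C * ε := mul_nonneg (one_pos.trans_le hC.1).le hε
  have hx := h.loopBody_x_mem (C := C) (ε := ε) (answer := answer)
  have hs := h.loopBody hlam hxs hC hε ho
  have heq := h.loopBody_hi_eq_lo hdone
  have hlo := h.loopBody_lo_eq hCε hdone
  have hxy : (loopBody G.X C ε lam answer s).x (loopBody G.X C ε lam answer s).y =
      (loopBody G.X C ε lam answer s).lo (loopBody G.X C ε lam answer s).y :=
    le_antisymm ((hx.2.2 _).trans (heq.trans hlo.symm).le) (h.loopBody_lo_le_x hCε _)
  refine SecurityGame.v_le_of_mem_approxBestResp hxs hC hx.1 (ho s.queries _ hx.1) ?_ ?_ hz w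
  · exact hxy.le.trans (hs.lo_le_xs _)
  · exact (hs.xs_le_lo_add _ hdone).trans_eq (congrArg (· + lam) hxy.symm)

/-- The number of rounds allowed by the potential argument. -/
lemma rounds_le [NeZero n] {Z r : ℝ} (hr : r = 4 * Z / n) (h1 : 1 ≤ r) {m : ℕ}
    (hm : (16 / 11 : ℝ) ^ m ≤ (33 * (n : ℝ) ^ 3 * r) ^ n) :
    (m : ℝ) ≤ 40 * (n * max 1 (Real.log Z)) := by
  have hn : (1 : ℝ) ≤ n := Nat.one_le_cast.2 (Nat.pos_of_ne_zero (NeZero.ne n))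
  have hn0 : (0 : ℝ) < n := by linarith
  have hnZ : n ≤ 4 * Z := by
    rwa [hr, le_div_iff₀ hn0, one_mul] at h1
  have hZ : 0 < Z := by linarith
  have hbase : 33 * (n : ℝ) ^ 3 * r ≤ 2 ^ 12 * Z ^ 3 := by
    have h2 : 33 * (n : ℝ) ^ 3 * r = 132 * Z * (n : ℝ) ^ 2 := by
      rw [hr]
      field_simp
      norm_num
    have h3 : (n : ℝ) ^ 2 ≤ (4 * Z) ^ 2 := pow_le_pow_left₀ hn0.le hnZ 2
    rw [h2]
    nlinarith [mul_le_mul_of_nonneg_left h3 hZ.le, pow_pos hZ 3]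
  have hlog := Real.log_le_log (by positivity) (hm.trans (pow_le_pow_left₀ (by positivity) hbase n))
  rw [Real.log_pow, Real.log_pow, Real.log_mul (by positivity) (by positivity), Real.log_pow,
    Real.log_pow] at hlog
  have hlow : (5 / 16 : ℝ) ≤ Real.log (16 / 11) := by
    have := Real.one_sub_inv_le_log_of_pos (by norm_num : (0 : ℝ) < 16 / 11)
    norm_num at this ⊢
    linarith
  have hlog2 : Real.log 2 < 0.7 := Real.log_two_lt_d9.trans (by norm_num)
  set Q := max 1 (Real.log Z) with hQ
  have hQ1 : 1 ≤ Q := le_max_left _ _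
  have hQ2 : Real.log Z ≤ Q := le_max_right _ _
  push_cast at hlog
  have h4 : 12 * Real.log 2 + 3 * Real.log Z ≤ 12 * Q := by linarith
  have h5 := mul_le_mul_of_nonneg_left h4 hn0.le
  have h6 := mul_le_mul_of_nonneg_left hlow (Nat.cast_nonneg (α := ℝ) m)
  have h7 : 0 ≤ n * Q := by positivity
  linarith

/-- The number of rounds of a binary search. -/
lemma search_rounds_le {Z : ℝ} {k : ℕ} (h : (2 : ℝ) ^ k ≤ 4 * Z) :
    (k : ℝ) + 1 ≤ 5 * max 1 (Real.log Z) := by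
  have hZ : 0 < Z := by
    have : (0 : ℝ) < 2 ^ k := by positivity
    linarith
  have hlog := Real.log_le_log (by positivity) h
  rw [Real.log_pow, Real.log_mul (by norm_num) hZ.ne', show (4 : ℝ) = 2 ^ 2 by norm_num,
    Real.log_pow] at hlog
  have h1 : 0.69 < Real.log 2 := lt_trans (by norm_num) Real.log_two_gt_d9
  have h2 : Real.log 2 < 0.7 := Real.log_two_lt_d9.trans (by norm_num)
  set Q := max 1 (Real.log Z) with hQ
  have hQ1 : 1 ≤ Q := le_max_left _ _
  have hQ2 : Real.log Z ≤ Q := le_max_right _ _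
  have h3 := mul_le_mul_of_nonneg_left h1.le (Nat.cast_nonneg (α := ℝ) k)
  push_cast at hlog
  linarith

lemma exists_mem_clinch [NeZero n] {G : SecurityGame n} {C δ ε : ℝ} (hC : G.HasSlopeBound C)
    (hδ : 0 < δ) (hε : ε = δ / (33 * C ^ 3 * n)) {xs : Fin n → ℝ}
    (hxs : G.IsConservativeOptimum xs) {answer : ℕ → (Fin n → ℝ) → Fin n}
    (ho : G.IsApproxOracle ε answer) {lo hi : Fin n → ℝ} (hlo : lo ≤ xs) (hhi : xs ≤ hi) :
    ∃ (xhat : Fin n → ℝ) (q : ℕ), (xhat, q) ∈ clinch G.X C δ ε lo hi answer ∧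
      xhat ∈ G.X ∧ ‖xhat - xs‖ ≤ δ ∧
      (q : ℝ) ≤ 50 * (n * max 1 (Real.log (C ^ 2 * (⨆ y, (hi y - lo y)) * n / δ))) := by
  have hn : (1 : ℝ) ≤ n := Nat.one_le_cast.2 (Nat.pos_of_ne_zero (NeZero.ne n))
  have hC1 : 1 ≤ C := hC.1
  have hC0 : 0 < C := one_pos.trans_le hC1
  have hε0 : 0 ≤ ε := by rw [hε]; positivity
  set lam := δ / (4 * C ^ 2) with hlam
  have hlam0 : 0 < lam := by positivity
  have hCε : C * ε = 4 * lam / (33 * n) := by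
    rw [hε, hlam]
    field_simp
  have hCε0 : 0 ≤ C * ε := by positivity
  set α := ⨆ y, (hi y - lo y) with hα
  have hαle : ∀ z, hi z - lo z ≤ α := fun z =>
    le_ciSup (f := fun y => hi y - lo y) (Set.finite_range _).bddAbove z
  set Z := C ^ 2 * α * n / δ with hZ
  set Q := max 1 (Real.log Z) with hQ
  have hQ1 : 1 ≤ Q := le_max_left _ _
  have hαlam : α / lam = 4 * Z / n := by
    rw [hlam, hZ]
    field_simp
  set f := loopBody G.X C ε lam answer with hf
  set s₀ := initState G.X lo hi with hs₀
  have hinv₀ : Invariant G lam xs lo hi s₀ := invariant_initState hxs.1 hlo hhi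
  have hinv : ∀ j, Invariant G lam xs lo hi (f^[j] s₀) := by
    intro j
    induction j with
    | zero => exact hinv₀
    | succ j ih =>
      rw [Function.iterate_succ_apply']
      exact ih.loopBody hlam0.le hxs hC hε0 ho
  have hq : ∀ j, (f^[j] s₀).queries = j := by
    intro j
    induction j with
    | zero => rfl
    | succ j ih =>
      rw [Function.iterate_succ_apply']
      exact congrArg (· + 1) ih
  -- the main loop
  obtain ⟨k, hkB, hdone, -, hmem⟩ := exists_iterate_mem_whileLoop
    (cond := fun s : LoopState n => s.y ∈ s.R) (body := f) (s := s₀) (B := 2 + 40 * (n * Q)) (by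
      intro k hk
      have hnQ : 0 ≤ 40 * (n * Q) := by positivity
      rcases le_or_gt k 2 with hk2 | hk2
      · have : (k : ℝ) ≤ 2 := by exact_mod_cast hk2
        linarith
      · obtain ⟨m, rfl⟩ : ∃ m, k = m + 2 := ⟨k - 2, by omega⟩
        obtain ⟨h1, h2⟩ := pow_le_of_forall_mem_R hinv₀ hlam0 hxs hC hε0 ho hCε hαle
          (by omega : 0 < m) hk
        have := rounds_le hαlam ((one_le_div hlam0).2 h1) h2
        push_cast
        linarith)
  obtain ⟨j, rfl⟩ : ∃ j, k = j + 1 := by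
    rcases k with _ | j
    · exact absurd (Set.mem_univ _) hdone
    · exact ⟨j, rfl⟩
  set s := f^[j + 1] s₀ with hs
  have hsf : s = f (f^[j] s₀) := Function.iterate_succ_apply' f j s₀
  have hsinv : Invariant G lam xs lo hi s := hinv (j + 1)
  have hxmem : s.x ∈ region G.X (f^[j] s₀).lo s.hi := hsf ▸ (hinv j).loopBody_x_mem
  have hlox : s.lo ≤ s.x := hsf ▸ (hinv j).loopBody_lo_le_x hCε0
  have hV : ∀ z, 0 < xs z → ∀ w, G.v w (s.x w) ≤ G.v z (xs z) + C * lam + ε := by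
    intro z hz w
    have hdone' : (f (f^[j] s₀)).y ∉ (f (f^[j] s₀)).R := hsf ▸ hdone
    rw [hsf]
    exact (hinv j).v_le_of_notMem_R hlam0.le hxs hC hε0 ho hdone' hz w
  have hlo0 : 0 ≤ s.lo := (G.subset_cube hsinv.lo_mem).1
  -- the binary searches
  obtain ⟨r, hr, hrP, hrq⟩ := exists_mem_conserveMass (answer := answer) (x := s.x) (lam := lam)
    s.lo (P := fun z a => s.lo z ≤ a ∧ a ≤ s.x z ∧ a ≤ xs z + C * ε ∧
      xs z ≤ a + (lam + C * (C * lam + 2 * ε))) (B := 5 * Q) (by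
      intro z q
      obtain ⟨t, ht, h1, h2, h3, h4, h5⟩ := exists_mem_whileLoop_search hxs hC hε0 hlam0 ho
        hxmem.1 (hlo0 z) (hlox z) (hsinv.lo_le_xs z) (hV z) (B := 5 * Q) (by positivity) (by
          intro i hi'
          apply search_rounds_le
          have h1 : lam * 2 ^ i ≤ α := by
            have := hxmem.2.2 z
            have := hsinv.hi_le z
            have := hsinv.le_lo z
            linarith [hαle z]
          have hα0 : 0 ≤ α := le_trans (by positivity) h1
          have h2 : (2 : ℝ) ^ i ≤ α / lam := by
            rw [le_div_iff₀ hlam0]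
            linarith
          have hZ0 : 0 ≤ Z := by positivity
          rw [hαlam] at h2
          exact h2.trans (div_le_self (by positivity) hn)) q
      exact ⟨t, ht, ⟨h1, h2, h3, h4⟩, h5⟩) s.queries
  refine ⟨r.1, r.2, Part.mem_bind hmem hr, ?_, ?_, ?_⟩
  · exact mem_of_le G hxmem.1 (hlo0.trans fun z => (hrP z).1) fun z => (hrP z).2.1
  · rw [pi_norm_le_iff_of_nonneg hδ.le]
    intro z
    obtain ⟨-, -, h3, h4⟩ := hrP z
    have h5 : C * (C * lam) = δ / 4 := by
      rw [hlam]
      field_simp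
    have h6 : lam ≤ δ / 4 := by
      rw [← h5]
      nlinarith [mul_le_mul hC1 hC1 zero_le_one hC0.le]
    have h7 : C * ε ≤ 4 / 33 * lam := by
      rw [hCε, div_le_iff₀ (by positivity)]
      nlinarith
    rw [Real.norm_eq_abs, Pi.sub_apply, abs_le]
    constructor <;> linarith
  · rw [hq] at hrq
    have h8 : 1 ≤ n * Q := one_le_mul_of_one_le_of_one_le hn hQ1
    linarith

end Main

end Clinch

theorem mainTheorem1 :
    ∃ K : ℝ, 0 < K ∧
      ∀ (n : ℕ) [NeZero n] (G : SecurityGame n) (C δ ε : ℝ),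
        G.HasSlopeBound C → 0 < δ → δ ≤ 1 → ε = δ / (33 * C ^ 3 * n) →
      ∀ xs : Fin n → ℝ, G.IsConservativeOptimum xs →
      ∀ oracle : ℕ → (Fin n → ℝ) → Fin n, G.IsApproxOracle ε oracle →
        (∀ lo hi : Fin n → ℝ, lo ≤ xs → xs ≤ hi →
          ∃ (xhat : Fin n → ℝ) (q : ℕ),
            (xhat, q) ∈ Clinch.clinch G.X C δ ε lo hi oracle ∧
            xhat ∈ G.X ∧ ‖xhat - xs‖ ≤ δ ∧
            (q : ℝ) ≤ K * (n * max 1 (Real.log (C ^ 2 * (⨆ y, (hi y - lo y)) * n / δ)))) ∧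
        (∃ (xhat : Fin n → ℝ) (q : ℕ),
            (xhat, q) ∈ Clinch.clinch G.X C δ ε 0 1 oracle ∧
            xhat ∈ G.X ∧ ‖xhat - xs‖ ≤ δ ∧
            (q : ℝ) ≤ K * (n * max 1 (Real.log (C * n / δ)))) := by
  refine ⟨100, by norm_num, ?_⟩
  intro n _ G C δ ε hC hδ hδ1 hε xs hxs oracle ho
  have hn : (1 : ℝ) ≤ n := Nat.one_le_cast.2 (Nat.pos_of_ne_zero (NeZero.ne n))
  have hC1 : 1 ≤ C := hC.1
  constructor
  · intro lo hi hlo hhi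
    obtain ⟨xhat, q, h1, h2, h3, h4⟩ := Clinch.exists_mem_clinch hC hδ hε hxs ho hlo hhi
    refine ⟨xhat, q, h1, h2, h3, h4.trans ?_⟩
    exact mul_le_mul_of_nonneg_right (by norm_num) (by positivity)
  · obtain ⟨xhat, q, h1, h2, h3, h4⟩ := Clinch.exists_mem_clinch hC hδ hε hxs ho
      (G.subset_cube hxs.1).1 (G.subset_cube hxs.1).2
    refine ⟨xhat, q, h1, h2, h3, h4.trans ?_⟩
    have hα : ⨆ y : Fin n, ((1 : Fin n → ℝ) y - (0 : Fin n → ℝ) y) = 1 := by simp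
    -- squaring costs the factor of two between the constants
    have hle : C ^ 2 * 1 * n / δ ≤ (C * n / δ) ^ 2 := by
      rw [div_pow, div_le_div_iff₀ hδ (by positivity)]
      have h5 : δ * 1 ≤ 1 * (n : ℝ) := mul_le_mul hδ1 hn zero_le_one zero_le_one
      have : 0 ≤ C ^ 2 * n * δ := by positivity
      nlinarith
    have hlog := Real.log_le_log (by positivity) hle
    rw [Real.log_pow] at hlog
    push_cast at hlog
    have hmax : max 1 (Real.log (C ^ 2 * 1 * n / δ)) ≤ 2 * max 1 (Real.log (C * n / δ)) := by
      have h6 := le_max_left 1 (Real.log (C * n / δ))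
      have h7 := le_max_right 1 (Real.log (C * n / δ))
      exact max_le (by linarith) (by linarith)
    rw [hα]
    have := mul_le_mul_of_nonneg_left hmax (by linarith : (0 : ℝ) ≤ n)
    linarith
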